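/- Let $n$ be any integer and let $G_n$ be the knot group of the $(-2,3,2n+1)$-pretzel knot, given by the Wirtinger presentation of the standard diagram, whose three twisted columns have $-2$, $3$ and $2n+1$ crossings. At the top of the diagram there are three arcs, each joining two of the columns. Let $a$ be the meridian of the arc joining the first and the second column, directed downwards into the first one, and let $c$ and $b$ be the meridians of the two arcs that end at the third column, on its left and on its right respectively, both directed downwards into it. (With these meridians $G_n=\langle a,b,c\mid cacb=acba,\ ba(cb)^n=a(cb)^nc\rangle$.) Put $w=cb$. The universal $SL_2$-character ring of a group $G$ is the commutative $\mathbb C$-algebra generated by symbols $t_g$ $(g\in G)$ with the relations $t_1=2$ and $t_gt_h=t_{gh}+t_{gh^{-1}}$ for all $g,h\in G$. Define $S_k(y)\in\mathbb Z[y]$ for all integers $k$ by $S_0=1$, $S_1=y$, $S_{k+1}=yS_k-S_{k-1}$, and in $\mathbb C[x,y,z]$ let $$P=x-xy+(-3+x^2+y^2)z-xyz^2+z^3,$$ $$Q_n=S_{n-2}(y)+S_{n-3}(y)-S_{n-4}(y)-S_{n-5}(y)-S_{n-2}(y)\,x^2+\big(S_{n-1}(y)+S_{n-3}(y)+S_{n-4}(y)\big)xz-\big(S_{n-2}(y)+S_{n-3}(y)\big)z^2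 .$$ **Theorem.** For every integer $n$: 1. the universal $SL_2$-character ring of $G_n$ is reduced; 2. $x\mapsto t_a$, $y\mapsto t_w$, $z\mapsto t_{aw}$ induces an isomorphism of $\mathbb C$-algebras from $\mathbb C[x,y,z]/(P,Q_n)$ onto the universal $SL_2$-character ring of $G_n$; 3. the same ring is obtained from traces of words: $a$ and $w$ generate $G_n$; for every word $v$ in the free group $F_2=\langle a,w\rangle$ there is a polynomial $\mathbf P_v\in\mathbb C[x,y,z]$ with $\operatorname{tr}r(v)=\mathbf P_v\big(\operatorname{tr}r(a),\operatorname{tr}r(w),\operatorname{tr}r(aw)\big)$ for all representations $r:F_2\to SL_2(\mathbb C)$; and the ideal of $\mathbb C[x,y,z]$ generated by all differences $\mathbf P_v-\mathbf P_{v'}$, where $v,v'$ are words that are equal in $G_n$, is $(P,Q_n)$. -/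

import Mathlib

open MvPolynomial

/-- The effect of one crossing of a twisted column on meridians. Two strands run down the page, and
`(x, y)` are the meridians (for the downward orientation, base point above the page) of the left
and the right one. In a crossing of positive sense the left strand passes over to the right: its
meridian does not change, and the Wirtinger relation turns the meridian `y` of the strand below
into `x * y * x⁻¹`. The inverse is the crossing of the opposite sense. -/
def halfTwist (H : Type*) [Group H] : Equiv.Perm (H × H) where
  toFun s := (s.1 * s.2 * s.1⁻¹, s.1)
  invFun s := (s.2, s.2⁻¹ * s.1 * s.2)
  left_inv s := by ext <;> simp [mul_assoc]
  right_inv s := by ext <;> simp [mul_assoc]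

/-- The meridians `(left, right)` at the bottom of the `i`-th column, which has `p i` crossings, in
the standard diagram of the three-column pretzel link. The generator `FreeGroup.of i` is the
meridian of the arc joining the top right end of column `i` to the top left end of column `i + 1`
(indices modulo `3`), oriented downward at column `i`, hence upward at column `i + 1`. -/
def pretzelBottom (p : Fin 3 → ℤ) (i : Fin 3) : FreeGroup (Fin 3) × FreeGroup (Fin 3) :=
  (halfTwist (FreeGroup (Fin 3)) ^ p i) ((FreeGroup.of (i - 1))⁻¹, FreeGroup.of i)

/-- The remaining Wirtinger relations: the bottom right end of column `i` is joined to the bottom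
left end of column `i + 1`, so that their downward meridians are inverse to each other. -/
def pretzelRels (p : Fin 3 → ℤ) : Set (FreeGroup (Fin 3)) :=
  Set.range fun i => (pretzelBottom p i).2 * (pretzelBottom p (i + 1)).1

/-- The group of the `(p 0, p 1, p 2)`-pretzel link: the Wirtinger group of its standard diagram
(with the meridians of the arcs inside the columns eliminated). -/
abbrev PretzelGroup (p : Fin 3 → ℤ) : Type := PresentedGroup (pretzelRels p)

/-- The relations `t_1 = 2` and `t_g t_h = t_{gh} + t_{gh⁻¹}` between the formal traces `t_g`. -/
noncomputable def characterIdeal (G : Type*) [Group G] : Ideal (MvPolynomial G ℂ) :=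
  Ideal.span ({X 1 - C 2} ∪
    {f | ∃ g h : G, f = X g * X h - (X (g * h) + X (g * h⁻¹))})

/-- The universal `SL₂`-character ring of a group, as its skein algebra: the commutative
`ℂ`-algebra generated by formal traces `t_g`, subject to the trace identities of `SL₂`. -/
abbrev UniversalCharacterRing (G : Type*) [Group G] : Type _ :=
  MvPolynomial G ℂ ⧸ characterIdeal G

/-- The formal trace `t_g` in the universal character ring. -/
noncomputable def formalTrace {G : Type*} [Group G] (g : G) : UniversalCharacterRing G :=
  Ideal.Quotient.mk (characterIdeal G) (X g)

/-- `p` is a trace polynomial of the word `v` with respect to the words `u i`: for every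
representation `ρ` of the free group in `SL₂(ℂ)`, substituting `tr ρ(u i)` in `p` gives
`tr ρ(v)`. -/
def IsTracePolynomial {α ι : Type*} (u : ι → FreeGroup α) (v : FreeGroup α)
    (p : MvPolynomial ι ℂ) : Prop :=
  ∀ ρ : FreeGroup α →* Matrix.SpecialLinearGroup (Fin 2) ℂ,
    eval (fun i => (ρ (u i)).1.trace) p = (ρ v).1.trace

/-- The letters in `α` are generators of `G` (through `π`), and the traces of the words `u i`
determine the trace of every word polynomially. -/
def IsTraceSystem {α ι G : Type*} [Group G] (π : FreeGroup α →* G) (u : ι → FreeGroup α) : Prop :=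
  Function.Surjective π ∧ ∀ v : FreeGroup α, ∃ p : MvPolynomial ι ℂ, IsTracePolynomial u v p

/-- The ideal generated by all `tr(v) - tr(w)`, where `v` and `w` are words that are equal in `G`,
with their traces written as polynomials in the traces of the `u i`. -/
noncomputable def traceIdeal {α ι G : Type*} [Group G] (π : FreeGroup α →* G) (u : ι → FreeGroup α) :
    Ideal (MvPolynomial ι ℂ) :=
  Ideal.span {f | ∃ (v w : FreeGroup α) (p q : MvPolynomial ι ℂ), π v = π w ∧
    IsTracePolynomial u v p ∧ IsTracePolynomial u w q ∧ f = p - q}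

/-- The Chebyshev polynomial `S_k(y)` for `k : ℤ` in `ℂ[x, y, z]`, where `x`, `y`, `z` are `X 0`,
`X 1`, `X 2`: `S_0 = 1`, `S_1 = y`, `S_{k+1} = y S_k - S_{k-1}`. -/
noncomputable def chebS (k : ℤ) : MvPolynomial (Fin 3) ℂ :=
  Polynomial.aeval (X 1 : MvPolynomial (Fin 3) ℂ) (Polynomial.Chebyshev.S ℂ k)

/-- `P = x - xy + (-3 + x² + y²) z - xyz² + z³`. -/
noncomputable def polyP : MvPolynomial (Fin 3) ℂ :=
  X 0 - X 0 * X 1 + (-3 + X 0 ^ 2 + X 1 ^ 2) * X 2 - X 0 * X 1 * X 2 ^ 2 + X 2 ^ 3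

/-- The polynomial `Q_n`. -/
noncomputable def polyQ (n : ℤ) : MvPolynomial (Fin 3) ℂ :=
  chebS (n - 2) + chebS (n - 3) - chebS (n - 4) - chebS (n - 5) - chebS (n - 2) * X 0 ^ 2
    + (chebS (n - 1) + chebS (n - 3) + chebS (n - 4)) * (X 0 * X 2)
    - (chebS (n - 2) + chebS (n - 3)) * X 2 ^ 2

/-- The group of the `(-2, 3, 2n+1)`-pretzel knot. -/
abbrev KnotGroup (n : ℤ) : Type := PretzelGroup ![-2, 3, 2 * n + 1]

/-- The meridian `a`. -/
def meridianA (n : ℤ) : KnotGroup n := PresentedGroup.of 0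

/-- The meridian `b`. -/
def meridianB (n : ℤ) : KnotGroup n := PresentedGroup.of 2

/-- The meridian `c`. -/
def meridianC (n : ℤ) : KnotGroup n := (PresentedGroup.of 1)⁻¹

/-- The element `w = cb`. -/
def elementW (n : ℤ) : KnotGroup n := meridianC n * meridianB n

/-- The free group on two letters mapped to the knot group: the letters go to `a` and `w`. -/
def wordMap (n : ℤ) : FreeGroup (Fin 2) →* KnotGroup n :=
  FreeGroup.lift ![meridianA n, elementW n]

/-- The words `a`, `w`, `aw`, whose traces are `x`, `y`, `z`. -/
def traceWords : Fin 3 → FreeGroup (Fin 2) :=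
  ![FreeGroup.of 0, FreeGroup.of 1, FreeGroup.of 0 * FreeGroup.of 1]

/-! Two independent facts carry the theorem: the trace ideal is (P, Q_n), and (P, Q_n) is radical.

The ideal (`PretzelKnot.traceIdeal_wordMap`). The relation cacb = acba expresses c, and then b =
c⁻¹w, through a and w, so G_n has generators a, w and one relation u = v, the right side of
`PretzelKnot.relation_iff`. For a trace function T, each h + h⁻¹ acts as a scalar, so every T(ug) -
T(vg) is a combination of the values at g = 1, a, w, aw. For the trace polynomials of F_2 these four
values lie in (P, Q_n) (`traceDiff_values`); hence modulo (P, Q_n) the traces factor through G_n.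
Conversely P = tr a - tr b is a trace difference because a and b are conjugate in G_n, and Q_n is a
combination of P and three of the four values. By `ker_evalTraces` the universal ring is the
quotient by the same ideal.

Radicality. P is monic in z, and the norm of Q_n modulo P is monic in y (`monic_normQ`), so
ℂ[x,y,z]/(P, Q_n) is finite and torsion-free over ℂ[x]. If the fibre x = 0 is reduced, a nilpotent
element is x times another element, which is nilpotent too; Nakayama's lemma and torsion-freeness
then kill the nilradical. On that fibre P = z(z² + y² - 3), and on either component Q_n is a
polynomial in y alone: (y+2)(S_{n-3} - S_{n-4}) or S_n + S_{n-1}. Both are separable, because the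
odd number that appears in their differential equations is not zero. -/

/-! ### Separability and coprimality of Chebyshev polynomials -/

namespace ChebyshevS

open Polynomial (derivative)

variable (R : Type*) [CommRing R]

/-- `S_n + S_{n-1}`, the third-kind analogue of the Chebyshev polynomials `S`. -/
noncomputable def sumS (n : ℤ) : Polynomial R :=
  Polynomial.Chebyshev.S R n + Polynomial.Chebyshev.S R (n - 1)

/-- `S_n - S_{n-1}`, the fourth-kind analogue of the Chebyshev polynomials `S`. -/
noncomputable def diffS (n : ℤ) : Polynomial R :=
  Polynomial.Chebyshev.S R n - Polynomial.Chebyshev.S R (n - 1)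

theorem S_pell (n : ℤ) :
    Polynomial.Chebyshev.S R n ^ 2 + Polynomial.Chebyshev.S R (n - 1) ^ 2
      - Polynomial.X * Polynomial.Chebyshev.S R n * Polynomial.Chebyshev.S R (n - 1) = 1 := by
  have h := Polynomial.Chebyshev.S_sq_add_S_sq R (n - 1)
  rw [sub_add_cancel] at h
  linear_combination h

/-- At X = 2 cos θ, `sumS` is sin((n+½)θ)/sin(θ/2) and `diffS` is cos((n+½)θ)/cos(θ/2), so this is
cos² + sin² = 1. -/
theorem sumS_diffS_pell (n : ℤ) :
    (Polynomial.X + 2) * diffS R n ^ 2 - (Polynomial.X - 2) * sumS R n ^ 2 = 4 := by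
  unfold sumS diffS
  linear_combination 4 * S_pell R n

/-- The two relations need each other in the induction. Solving them for one derivative would
introduce the factor X² - 4. -/
theorem derivative_S (n : ℤ) :
    Polynomial.X * derivative (Polynomial.Chebyshev.S R n)
        - 2 * derivative (Polynomial.Chebyshev.S R (n - 1))
      = (n : Polynomial R) * Polynomial.Chebyshev.S R n ∧
    2 * derivative (Polynomial.Chebyshev.S R n)
        - Polynomial.X * derivative (Polynomial.Chebyshev.S R (n - 1))
      = ((n : Polynomial R) + 1) * Polynomial.Chebyshev.S R (n - 1) := by
  induction n using Int.induction_on with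
  | zero => simp
  | succ k ih =>
    obtain ⟨h1, h2⟩ := ih
    simp only [add_sub_cancel_right, Polynomial.Chebyshev.S_add_one R k, Polynomial.derivative_sub,
      Polynomial.derivative_mul, Polynomial.derivative_X, Int.cast_add, Int.cast_one]
    constructor
    · linear_combination Polynomial.X * h1 - h2
    · linear_combination h1
  | pred k ih =>
    obtain ⟨h1, h2⟩ := ih
    have e := Polynomial.Chebyshev.S_sub_two R (-(k : ℤ))
    have e' : -(k : ℤ) - 1 - 1 = -(k : ℤ) - 2 := by ring
    simp only [e', e, Polynomial.derivative_sub,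
      Polynomial.derivative_mul, Polynomial.derivative_X, Int.cast_sub, Int.cast_one]
    constructor
    · linear_combination h2
    · linear_combination Polynomial.X * h2 - h1

theorem derivative_sumS (n : ℤ) :
    sumS R n + 2 * (Polynomial.X - 2) * derivative (sumS R n)
      = (2 * (n : Polynomial R) + 1) * diffS R n := by
  obtain ⟨h1, h2⟩ := derivative_S R n
  simp only [sumS, diffS, Polynomial.derivative_add]
  linear_combination 2 * h1 - 2 * h2

theorem derivative_diffS (n : ℤ) :
    diffS R n + 2 * (Polynomial.X + 2) * derivative (diffS R n)
      = (2 * (n : Polynomial R) + 1) * sumS R n := by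
  obtain ⟨h1, h2⟩ := derivative_S R n
  simp only [sumS, diffS, Polynomial.derivative_sub]
  linear_combination 2 * h1 + 2 * h2

section Complex

theorem isUnit_two_mul_add_one (n : ℤ) : IsUnit (2 * (n : Polynomial ℂ) + 1) := by
  have h : (2 * (n : ℂ) + 1) ≠ 0 := by
    have : (2 * n + 1 : ℤ) ≠ 0 := by omega
    exact_mod_cast this
  convert Polynomial.isUnit_C.mpr (isUnit_iff_ne_zero.mpr h) using 1
  simp [map_ofNat]

theorem isUnit_four : IsUnit (4 : Polynomial ℂ) := by
  rw [← map_ofNat Polynomial.C 4]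
  exact Polynomial.isUnit_C.mpr (isUnit_iff_ne_zero.mpr (by norm_num))

theorem isCoprime_sumS_diffS (n : ℤ) : IsCoprime (sumS ℂ n) (diffS ℂ n) := by
  obtain ⟨u, hu⟩ := isUnit_four.exists_left_inv
  exact ⟨-u * (Polynomial.X - 2) * sumS ℂ n, u * (Polynomial.X + 2) * diffS ℂ n,
    by linear_combination u * sumS_diffS_pell ℂ n + hu⟩

/-- By `derivative_sumS`, a common root of `sumS` and its derivative is a root of (2n+1) `diffS`,
which the Pell identity excludes since 2n+1 is odd, hence nonzero. -/
theorem separable_sumS (n : ℤ) : (sumS ℂ n).Separable := by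
  obtain ⟨u, hu⟩ := (isUnit_two_mul_add_one n).exists_left_inv
  obtain ⟨s, t, h⟩ := isCoprime_sumS_diffS n
  exact ⟨s + t * u, t * u * 2 * (Polynomial.X - 2),
    by linear_combination h + t * u * derivative_sumS ℂ n + t * diffS ℂ n * hu⟩

theorem separable_diffS (n : ℤ) : (diffS ℂ n).Separable := by
  obtain ⟨u, hu⟩ := (isUnit_two_mul_add_one n).exists_left_inv
  obtain ⟨s, t, h⟩ := isCoprime_sumS_diffS n
  exact ⟨t + s * u, s * u * 2 * (Polynomial.X + 2),
    by linear_combination h + s * u * derivative_diffS ℂ n + s * sumS ℂ n * hu⟩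

/-- Modulo X + 2 the derivative formula reads `diffS` ≡ (2n+1) `sumS`, and the Pell identity makes
`sumS` a unit there. -/
theorem isCoprime_X_add_two_diffS (n : ℤ) :
    IsCoprime (Polynomial.X + 2 : Polynomial ℂ) (diffS ℂ n) := by
  obtain ⟨u, hu⟩ := isUnit_four.exists_left_inv
  have h : IsCoprime (Polynomial.X + 2 : Polynomial ℂ) ((2 * (n : Polynomial ℂ) + 1) * sumS ℂ n) := by
    rw [isCoprime_mul_unit_left_right (isUnit_two_mul_add_one n)]
    exact ⟨u * (diffS ℂ n ^ 2 - sumS ℂ n ^ 2), u * 4 * sumS ℂ n,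
      by linear_combination u * sumS_diffS_pell ℂ n + hu⟩
  obtain ⟨s, t, h⟩ := h
  exact ⟨s + t * 2 * derivative (diffS ℂ n), t,
    by linear_combination h + t * derivative_diffS ℂ n⟩

theorem separable_X_add_two_mul_diffS (n : ℤ) :
    ((Polynomial.X + 2 : Polynomial ℂ) * diffS ℂ n).Separable := by
  refine Polynomial.Separable.mul ?_ (separable_diffS n) (isCoprime_X_add_two_diffS n)
  exact Polynomial.separable_X_add_C (2 : ℂ)

/-- For X = t + t⁻¹ the factor t³ + t⁻³ is X(X² - 3), so modulo X² - 3 a shift by 6 only changes the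
sign. -/
theorem sumS_add_six (n : ℤ) :
    sumS R (n + 6) = -sumS R n + (Polynomial.X ^ 2 - 3) * (Polynomial.X * sumS R (n + 3)) := by
  have key : ∀ k : ℤ, Polynomial.Chebyshev.S R (k + 6) = -Polynomial.Chebyshev.S R k
      + (Polynomial.X ^ 2 - 3) * (Polynomial.X * Polynomial.Chebyshev.S R (k + 3)) := by
    intro k
    have h2 := Polynomial.Chebyshev.S_add_two R k
    have h3 := Polynomial.Chebyshev.S_add_two R (k + 1)
    have h4 := Polynomial.Chebyshev.S_add_two R (k + 2)
    have h5 := Polynomial.Chebyshev.S_add_two R (k + 3)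
    have h6 := Polynomial.Chebyshev.S_add_two R (k + 4)
    ring_nf at h2 h3 h4 h5 h6 ⊢
    rw [h6, h5, h4, h3, h2]
    ring
  have e1 : n + 6 - 1 = n - 1 + 6 := by ring
  have e2 : n + 3 - 1 = n - 1 + 3 := by ring
  simp only [sumS, e1, e2, key]
  ring

theorem isCoprime_sumS_X_sq_sub_three (n : ℤ) :
    IsCoprime (sumS ℂ n) (Polynomial.X ^ 2 - 3 : Polynomial ℂ) := by
  have shift : ∀ r : ℤ, IsCoprime (sumS ℂ (r + 6)) (Polynomial.X ^ 2 - 3 : Polynomial ℂ) ↔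
      IsCoprime (sumS ℂ r) (Polynomial.X ^ 2 - 3 : Polynomial ℂ) := by
    intro r
    rw [sumS_add_six, IsCoprime.add_mul_left_left_iff, IsCoprime.neg_left_iff]
  have shifts : ∀ r k : ℤ, IsCoprime (sumS ℂ (r + 6 * k)) (Polynomial.X ^ 2 - 3 : Polynomial ℂ) ↔
      IsCoprime (sumS ℂ r) (Polynomial.X ^ 2 - 3 : Polynomial ℂ) := by
    intro r k
    induction k using Int.induction_on with
    | zero => simp
    | succ k ih => rw [← ih, ← shift (r + 6 * k)]; ring_nf
    | pred k ih => rw [← ih, ← shift (r + 6 * (-(k : ℤ) - 1))]; ring_nf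
  -- Up to sign only six residues remain; each gets an explicit Bézout identity.
  have hn : n = n % 6 + 6 * (n / 6) := by omega
  rw [hn, shifts]
  have h0 : 0 ≤ n % 6 := by omega
  have h6 : n % 6 < 6 := by omega
  obtain ⟨u, hu⟩ := isUnit_four.exists_left_inv
  have S3 : Polynomial.Chebyshev.S ℂ 3 = Polynomial.X ^ 3 - 2 * Polynomial.X := by
    have := Polynomial.Chebyshev.S_add_two ℂ 1
    norm_num [Polynomial.Chebyshev.S_two] at this; rw [this]; ring
  have S4 : Polynomial.Chebyshev.S ℂ 4 = Polynomial.X ^ 4 - 3 * Polynomial.X ^ 2 + 1 := by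
    have := Polynomial.Chebyshev.S_add_two ℂ 2
    norm_num [S3, Polynomial.Chebyshev.S_two] at this; rw [this]; ring
  have S5 : Polynomial.Chebyshev.S ℂ 5
      = Polynomial.X ^ 5 - 4 * Polynomial.X ^ 3 + 3 * Polynomial.X := by
    have := Polynomial.Chebyshev.S_add_two ℂ 3
    norm_num [S3, S4] at this; rw [this]; ring
  generalize n % 6 = r at h0 h6
  interval_cases r <;> norm_num [sumS, Polynomial.Chebyshev.S_two, S3, S4, S5]
  · exact isCoprime_one_left
  · exact ⟨2 * u * (Polynomial.X - 1), -2 * u, by linear_combination hu⟩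
  · exact ⟨2 - Polynomial.X, Polynomial.X - 1, by ring⟩
  · exact ⟨2 - Polynomial.X, 1 - (2 - Polynomial.X) * (Polynomial.X + 1), by ring⟩
  · exact ⟨2 * u * (Polynomial.X - 1),
      2 * u * (-1 - (Polynomial.X - 1) * (Polynomial.X ^ 2 + Polynomial.X)),
      by linear_combination hu⟩
  · exact ⟨1, -(Polynomial.X ^ 3 + Polynomial.X ^ 2 - Polynomial.X), by ring⟩

end Complex

end ChebyshevS

/-! ### Leading terms of Chebyshev polynomials -/

namespace ChebyshevS

open Polynomial (derivative)

section Monic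

variable (K : Type*) [CommRing K]

theorem monic_S_natDegree_S [Nontrivial K] (k : ℕ) : (Polynomial.Chebyshev.S K k).Monic ∧
    (Polynomial.Chebyshev.S K k).natDegree = k := by
  induction k using Nat.twoStepInduction with
  | zero => simp
  | one => simp [Polynomial.monic_X]
  | more k h0 h1 =>
    have e : Polynomial.Chebyshev.S K ((k + 2 : ℕ) : ℤ)
        = Polynomial.X * Polynomial.Chebyshev.S K ((k + 1 : ℕ) : ℤ)
          - Polynomial.Chebyshev.S K k := by
      push_cast
      exact Polynomial.Chebyshev.S_add_two K k
    have hm := Polynomial.monic_X.mul h1.1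
    have hd : (Polynomial.X * Polynomial.Chebyshev.S K ((k + 1 : ℕ) : ℤ)).natDegree = k + 2 := by
      rw [Polynomial.monic_X.natDegree_mul h1.1, h1.2, Polynomial.natDegree_X]; ring
    have hlt : (Polynomial.Chebyshev.S K k).natDegree
        < (Polynomial.X * Polynomial.Chebyshev.S K ((k + 1 : ℕ) : ℤ)).natDegree := by
      rw [hd, h0.2]; omega
    rw [e]
    refine ⟨hm.sub_of_left (Polynomial.degree_lt_degree hlt), ?_⟩
    rw [Polynomial.natDegree_sub_eq_left_of_natDegree_lt hlt, hd]

theorem monic_S [Nontrivial K] (k : ℕ) : (Polynomial.Chebyshev.S K k).Monic := (monic_S_natDegree_S K k).1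

theorem natDegree_S [Nontrivial K] (k : ℕ) : (Polynomial.Chebyshev.S K k).natDegree = k :=
  (monic_S_natDegree_S K k).2

variable {K}

theorem monic_add_of_natDegree_lt {f g : Polynomial K} (hf : f.Monic)
    (h : g.natDegree < f.natDegree) : (f + g).Monic :=
  hf.add_of_left (Polynomial.degree_lt_degree h)

/-- This is the shape of the dominating summand of `normQ`, with f = S_{k+1}, g = S_k, a = S_{k+2}
and c = 2 - x². -/
theorem monic_mul_X_add_C_sq [Nontrivial K] {f g : Polynomial K} {k : ℕ} (hf : f.Monic)
    (hfk : f.natDegree = k + 1) (hgk : g.natDegree = k) (c : K) {a : Polynomial K}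
    (ha : a.Monic) :
    (a ^ 2 * (f - g) * (Polynomial.X + Polynomial.C c) ^ 2).Monic ∧
    (a ^ 2 * (f - g) * (Polynomial.X + Polynomial.C c) ^ 2).natDegree
      = 2 * a.natDegree + k + 3 := by
  have hlt : g.natDegree < f.natDegree := by omega
  have hm := hf.sub_of_left (Polynomial.degree_lt_degree hlt)
  have hd := Polynomial.natDegree_sub_eq_left_of_natDegree_lt hlt
  have hX := (Polynomial.monic_X_add_C c).pow 2
  refine ⟨((ha.pow 2).mul hm).mul hX, ?_⟩
  rw [((ha.pow 2).mul hm).natDegree_mul hX, (ha.pow 2).natDegree_mul hm, hd, ha.natDegree_pow,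
    (Polynomial.monic_X_add_C c).natDegree_pow, Polynomial.natDegree_X_add_C, hfk]
  ring

end Monic

end ChebyshevS

/-! ### Elimination of z: the norm of Q_n -/

namespace PretzelElimination

section Identities

variable {A : Type*} [CommRing A]

/-- The polynomial `P` at a point of a commutative ring. -/
def evalP (x y z : A) : A :=
  x - x * y + (-3 + x ^ 2 + y ^ 2) * z - x * y * z ^ 2 + z ^ 3

/-- The polynomial `Q_n` at a point, with `p = S_{n-2}` and `q = S_{n-3}`. -/
def evalQ (x y z p q : A) : A :=
  p * (2 + y - x ^ 2) + q * (2 - y - y ^ 2) + ((y - 1) * p + y * q) * (x * z) - (p + q) * z ^ 2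

/-- The norm of `Q_n` from `ℂ[x, y, z]/(P)` to `ℂ[x, y]`, with `a = S_{n-1}` and `b = S_{n-2}`. -/
def normQ (x y a b : A) : A :=
  a ^ 2 * (a - (y - 1) * b) * (y + 2 - x ^ 2) ^ 2
    + a * (y ^ 4 + 3 * y ^ 3 - 7 * y - 6 - x ^ 2 * (y ^ 3 + 3 * y ^ 2 - y - 9)
      + x ^ 4 * (2 * y - 3))
    + b * (2 + 3 * y - y ^ 2 - y ^ 3 - 5 * x ^ 2 * (y + 1) + x ^ 4 * (2 * y + 4) - x ^ 6)

/-- The Pell relation trades a² for b². For n ≤ -2 this puts the dominating summand into the form of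
`monic_mul_X_add_C_sq` again. -/
theorem normQ_eq (x y a b : A) (h : a ^ 2 + b ^ 2 - y * a * b = 1) :
    normQ x y a b = b ^ 2 * ((y - 1) * a - b) * (y + 2 - x ^ 2) ^ 2
    + a * (y ^ 4 + 3 * y ^ 3 + y ^ 2 - 3 * y - 2 - x ^ 2 * (y ^ 3 + 3 * y ^ 2 + y - 5)
      + x ^ 4 * (2 * y - 2))
    + b * (6 + 7 * y - y ^ 3 - x ^ 2 * (7 * y + 9) + x ^ 4 * (2 * y + 5) - x ^ 6) := by
  unfold normQ
  linear_combination (x ^ 4 * a + x ^ 4 * b - 2 * x ^ 2 * y * a - 2 * x ^ 2 * y * b - 4 * x ^ 2 * a - 4 * x ^ 2 *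
    b + y ^ 2 * a + y ^ 2 * b + 4 * y * a + 4 * y * b + 4 * a + 4 * b) * h

/-- The cofactor of `Q_n` in the representation of its norm by `P` and `Q_n`. -/
def cofactorQ (x y z a b : A) : A :=
  -x ^ 4 * y * a * b + x ^ 4 * a ^ 2 + x ^ 4 * b ^ 2 + x ^ 3 * y ^ 2 * z * a * b - x ^ 3 * y *
    z * a ^ 2 + x ^ 3 * y * z * a * b - x ^ 3 * y * z * b ^ 2 - x ^ 3 * z * b ^ 2 + x ^ 2 * y ^
    2 * a * b - x ^ 2 * y * z ^ 2 * a * b - 2 * x ^ 2 * y * a ^ 2 + 2 * x ^ 2 * y * a * b - x ^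
    2 * y * b ^ 2 + x ^ 2 * z ^ 2 * a ^ 2 - x ^ 2 * z ^ 2 * a * b + x ^ 2 * z ^ 2 * b ^ 2 - 2 *
    x ^ 2 * a ^ 2 + x ^ 2 * a * b - 2 * x ^ 2 * b ^ 2 - x * y ^ 3 * z * a * b + x * y ^ 2 * z *
    a ^ 2 - 3 * x * y ^ 2 * z * a * b + x * y ^ 2 * z * b ^ 2 + 2 * x * y * z * a ^ 2 - x * y *
    z * a * b + 3 * x * y * z * b ^ 2 - x * z * a ^ 2 + x * z * b ^ 2 + y ^ 2 * z ^ 2 * a * b +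
    y ^ 2 * a ^ 2 - y * z ^ 2 * a ^ 2 + 2 * y * z ^ 2 * a * b - y * z ^ 2 * b ^ 2 + 2 * y * a ^
    2 - 2 * y * a * b - z ^ 2 * a ^ 2 + 2 * z ^ 2 * a * b - z ^ 2 * b ^ 2 + a ^ 2 - 2 * a * b +
    b ^ 2

/-- The cofactor of `P` in the representation of the norm of `Q_n` by `P` and `Q_n`. -/
def cofactorP (x y z a b : A) : A :=
  x ^ 3 * y ^ 3 * a * b ^ 2 - 2 * x ^ 3 * y ^ 2 * a ^ 2 * b + 2 * x ^ 3 * y ^ 2 * a * b ^ 2 -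
    x ^ 3 * y ^ 2 * b ^ 3 + x ^ 3 * y * a ^ 3 - 2 * x ^ 3 * y * a ^ 2 * b + x ^ 3 * y * a * b ^
    2 - 2 * x ^ 3 * y * b ^ 3 + x ^ 3 * a ^ 2 * b - x ^ 2 * y ^ 2 * z * a * b ^ 2 + 2 * x ^ 2 *
    y * z * a ^ 2 * b - 2 * x ^ 2 * y * z * a * b ^ 2 + x ^ 2 * y * z * b ^ 3 - x ^ 2 * z * a ^
    3 + 2 * x ^ 2 * z * a ^ 2 * b - 2 * x ^ 2 * z * a * b ^ 2 + x ^ 2 * z * b ^ 3 - x * y ^ 4 *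
    a * b ^ 2 + 2 * x * y ^ 3 * a ^ 2 * b - 4 * x * y ^ 3 * a * b ^ 2 + x * y ^ 3 * b ^ 3 - x *
    y ^ 2 * a ^ 3 + 6 * x * y ^ 2 * a ^ 2 * b - 4 * x * y ^ 2 * a * b ^ 2 + 4 * x * y ^ 2 * b ^
    3 - 2 * x * y * a ^ 3 + x * y * a ^ 2 * b - 2 * x * y * a * b ^ 2 + 3 * x * y * b ^ 3 + x *
    a ^ 3 - 2 * x * a ^ 2 * b + x * a * b ^ 2 + y ^ 3 * z * a * b ^ 2 - 2 * y ^ 2 * z * a ^ 2 *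
    b + 3 * y ^ 2 * z * a * b ^ 2 - y ^ 2 * z * b ^ 3 + y * z * a ^ 3 - 4 * y * z * a ^ 2 * b +
    5 * y * z * a * b ^ 2 - 2 * y * z * b ^ 3 + z * a ^ 3 - 3 * z * a ^ 2 * b + 3 * z * a * b ^
    2 - z * b ^ 3

/-- A norm is a multiple of the element modulo P. Pell's relation is needed because `normQ` has been
simplified by it; `hq` is the recurrence for S_{n-3}. -/
theorem normQ_eq_combination (x y z a b q : A) (h : a ^ 2 + b ^ 2 - y * a * b = 1)
    (hq : q = y * b - a) :
    normQ x y a b = cofactorP x y z a b * evalP x y z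
      + cofactorQ x y z a b * evalQ x y z b q := by
  subst hq
  unfold normQ cofactorP cofactorQ evalP evalQ
  linear_combination (x ^ 6 * b - 2 * x ^ 4 * y * a - 2 * x ^ 4 * y * b + 3 * x ^ 4 * a - 4 * x ^ 4 * b + x ^ 2 *
    y ^ 3 * a + 3 * x ^ 2 * y ^ 2 * a - x ^ 2 * y * a + 5 * x ^ 2 * y * b - 9 * x ^ 2 * a + 5 *
    x ^ 2 * b - y ^ 4 * a - 3 * y ^ 3 * a + y ^ 3 * b + y ^ 2 * b + 7 * y * a - 3 * y * b + 6 *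
    a - 2 * b) * h

end Identities

section Norm

variable {K : Type*} [CommRing K] [Nontrivial K]

/-- The norm of `Q_n` is monic in `y`. -/
theorem monic_normQ (x : K) (n : ℤ) :
    (normQ (Polynomial.C x) Polynomial.X (Polynomial.Chebyshev.S K (n - 1))
      (Polynomial.Chebyshev.S K (n - 2))).Monic := by
  have hc : (Polynomial.X + Polynomial.C (2 - x ^ 2) : Polynomial K)
      = Polynomial.X + 2 - Polynomial.C x ^ 2 := by
    rw [map_sub, map_pow, Polynomial.C_ofNat]; ring
  rcases le_or_gt 3 n with hn | hn
  -- Since a - (y-1)b = S_{n-2} - S_{n-3}, the first summand of the norm has degree 3k + 7 in y; the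
  -- others have degree at most k + 6.
  · obtain ⟨k, rfl⟩ : ∃ k : ℕ, n = k + 3 := ⟨(n - 3).toNat, by omega⟩
    have ea : ((k : ℤ) + 3 - 1) = ((k + 2 : ℕ) : ℤ) := by push_cast; ring
    have eb : ((k : ℤ) + 3 - 2) = ((k + 1 : ℕ) : ℤ) := by push_cast; ring
    rw [ea, eb]
    have hS : Polynomial.Chebyshev.S K ((k + 2 : ℕ) : ℤ)
        = Polynomial.X * Polynomial.Chebyshev.S K ((k + 1 : ℕ) : ℤ)
          - Polynomial.Chebyshev.S K k := by
      push_cast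
      exact Polynomial.Chebyshev.S_add_two K k
    have ha := ChebyshevS.natDegree_S K (k + 2)
    have hb := ChebyshevS.natDegree_S K (k + 1)
    obtain ⟨hM, hd⟩ := ChebyshevS.monic_mul_X_add_C_sq (ChebyshevS.monic_S K (k + 1))
      hb (ChebyshevS.natDegree_S K k) (2 - x ^ 2)
      (ChebyshevS.monic_S K (k + 2))
    have hC : (Polynomial.X ^ 4 + 3 * Polynomial.X ^ 3 - 7 * Polynomial.X - 6
        - Polynomial.C x ^ 2 * (Polynomial.X ^ 3 + 3 * Polynomial.X ^ 2 - Polynomial.X - 9)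
        + Polynomial.C x ^ 4 * (2 * Polynomial.X - 3) : Polynomial K).natDegree ≤ 4 := by
      compute_degree
    have hE : (2 + 3 * Polynomial.X - Polynomial.X ^ 2 - Polynomial.X ^ 3
        - 5 * Polynomial.C x ^ 2 * (Polynomial.X + 1)
        + Polynomial.C x ^ 4 * (2 * Polynomial.X + 4) - Polynomial.C x ^ 6 : Polynomial K).natDegree
          ≤ 3 := by
      compute_degree
    have hL := Polynomial.natDegree_add_le_of_le
      (Polynomial.natDegree_mul_le_of_le ha.le hC) (Polynomial.natDegree_mul_le_of_le hb.le hE)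
    convert ChebyshevS.monic_add_of_natDegree_lt hM (lt_of_le_of_lt hL ?_) using 1
    · unfold normQ
      rw [hc]
      linear_combination Polynomial.Chebyshev.S K ((k + 2 : ℕ) : ℤ) ^ 2
        * (Polynomial.X + 2 - Polynomial.C x ^ 2) ^ 2 * hS
    · rw [hd, ha]; omega
  rcases le_or_gt n (-2) with hn' | hn'
  -- The reflection S_{-j-2} = -S_j returns to nonnegative indices; the top degree is again 3k + 7.
  · obtain ⟨k, rfl⟩ : ∃ k : ℕ, n = -k - 2 := ⟨(-2 - n).toNat, by omega⟩
    have hpell := ChebyshevS.S_pell K (-k - 2 - 1)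
    have e0 : (-(k : ℤ) - 2 - 1 - 1) = -k - 2 - 2 := by ring
    have ea : Polynomial.Chebyshev.S K (-k - 2 - 1)
        = -Polynomial.Chebyshev.S K ((k + 1 : ℕ) : ℤ) := by
      rw [← Polynomial.Chebyshev.S_neg_sub_two]; congr 1; push_cast; ring
    have eb : Polynomial.Chebyshev.S K (-k - 2 - 2)
        = -Polynomial.Chebyshev.S K ((k + 2 : ℕ) : ℤ) := by
      rw [← Polynomial.Chebyshev.S_neg_sub_two]; congr 1; push_cast; ring
    rw [e0] at hpell
    rw [normQ_eq _ _ _ _ hpell, ea, eb]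
    have hS : Polynomial.Chebyshev.S K ((k + 2 : ℕ) : ℤ)
        = Polynomial.X * Polynomial.Chebyshev.S K ((k + 1 : ℕ) : ℤ)
          - Polynomial.Chebyshev.S K k := by
      push_cast
      exact Polynomial.Chebyshev.S_add_two K k
    have ha := ChebyshevS.natDegree_S K (k + 1)
    have hb := ChebyshevS.natDegree_S K (k + 2)
    obtain ⟨hM, hd⟩ := ChebyshevS.monic_mul_X_add_C_sq (ChebyshevS.monic_S K (k + 1))
      ha (ChebyshevS.natDegree_S K k) (2 - x ^ 2)
      (ChebyshevS.monic_S K (k + 2))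
    have hC : (Polynomial.X ^ 4 + 3 * Polynomial.X ^ 3 + Polynomial.X ^ 2 - 3 * Polynomial.X - 2
        - Polynomial.C x ^ 2 * (Polynomial.X ^ 3 + 3 * Polynomial.X ^ 2 + Polynomial.X - 5)
        + Polynomial.C x ^ 4 * (2 * Polynomial.X - 2) : Polynomial K).natDegree ≤ 4 := by
      compute_degree
    have hE : (6 + 7 * Polynomial.X - Polynomial.X ^ 3
        - Polynomial.C x ^ 2 * (7 * Polynomial.X + 9)
        + Polynomial.C x ^ 4 * (2 * Polynomial.X + 5) - Polynomial.C x ^ 6 : Polynomial K).natDegree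
          ≤ 3 := by
      compute_degree
    have ha' := (Polynomial.natDegree_neg (Polynomial.Chebyshev.S K ((k + 1 : ℕ) : ℤ))).trans ha
    have hb' := (Polynomial.natDegree_neg (Polynomial.Chebyshev.S K ((k + 2 : ℕ) : ℤ))).trans hb
    have hL := Polynomial.natDegree_add_le_of_le
      (Polynomial.natDegree_mul_le_of_le ha'.le hC) (Polynomial.natDegree_mul_le_of_le hb'.le hE)
    convert ChebyshevS.monic_add_of_natDegree_lt hM (lt_of_le_of_lt hL ?_) using 1
    · rw [hc]
      linear_combination Polynomial.Chebyshev.S K ((k + 2 : ℕ) : ℤ) ^ 2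
        * (Polynomial.X + 2 - Polynomial.C x ^ 2) ^ 2 * hS
    · rw [hd, hb]; omega
  have key : ∀ (g : Polynomial K) (d : ℕ), g.natDegree ≤ d →
      (Polynomial.X ^ (d + 1) + g).Monic := by
    intro g d h
    refine Polynomial.monic_X_pow_add (lt_of_le_of_lt (Polynomial.degree_le_of_natDegree_le h) ?_)
    exact_mod_cast d.lt_succ_self
  have S_neg_three : Polynomial.Chebyshev.S K (-3) = -Polynomial.X := by
    have := Polynomial.Chebyshev.S_neg_sub_two K 1
    norm_num at this
    exact this
  -- For n = -1, 0, 1, 2 the first summand need not dominate, so the norm is written out.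
  interval_cases n
  · have h := key (Polynomial.C x ^ 6 * Polynomial.X - Polynomial.C x ^ 4 *
      Polynomial.X ^ 2 - 7 * Polynomial.C x ^ 4 * Polynomial.X + 2 *
      Polynomial.C x ^ 4 - Polynomial.C x ^ 2 * Polynomial.X ^ 3 + 6 *
      Polynomial.C x ^ 2 * Polynomial.X ^ 2 + 10 * Polynomial.C x ^ 2 *
      Polynomial.X - 5 * Polynomial.C x ^ 2 + Polynomial.X ^ 3 - 4 * Polynomial.X ^ 2
      - 3 * Polynomial.X + 2) 3 (by compute_degree)
    convert h using 1
    norm_num [normQ, S_neg_three]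
    ring
  · have h := key (Polynomial.C x ^ 6 - 2 * Polynomial.C x ^ 4 * Polynomial.X - 4 *
      Polynomial.C x ^ 4 + 5 * Polynomial.C x ^ 2 * Polynomial.X + 5 *
      Polynomial.C x ^ 2 + Polynomial.X ^ 2 - 3 * Polynomial.X - 2) 2 (by compute_degree)
    convert h using 1
    norm_num [normQ, S_neg_three]
    ring
  · have h := key (2 * Polynomial.C x ^ 4 * Polynomial.X - 2 * Polynomial.C x ^ 4 -
      Polynomial.C x ^ 2 * Polynomial.X ^ 3 - 3 * Polynomial.C x ^ 2 *
      Polynomial.X ^ 2 - Polynomial.C x ^ 2 * Polynomial.X + 5 *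
      Polynomial.C x ^ 2 + 3 * Polynomial.X ^ 3 + Polynomial.X ^ 2 - 3 * Polynomial.X
      - 2) 3 (by compute_degree)
    convert h using 1
    norm_num [normQ, S_neg_three]
    ring
  · have h := key (-Polynomial.C x ^ 6 + 3 * Polynomial.C x ^ 4 * Polynomial.X ^ 2 -
      Polynomial.C x ^ 4 * Polynomial.X + 4 * Polynomial.C x ^ 4 -
      Polynomial.C x ^ 2 * Polynomial.X ^ 4 - 5 * Polynomial.C x ^ 2 *
      Polynomial.X ^ 3 - 3 * Polynomial.C x ^ 2 * Polynomial.X ^ 2 + 4 *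
      Polynomial.C x ^ 2 * Polynomial.X - 5 * Polynomial.C x ^ 2 + 4 *
      Polynomial.X ^ 4 + 3 * Polynomial.X ^ 3 - 4 * Polynomial.X ^ 2 - 3 * Polynomial.X + 2) 4 (by compute_degree)
    convert h using 1
    norm_num [normQ, S_neg_three]
    ring

end Norm

end PretzelElimination

/-! ### Torsion-freeness, and reducedness from one fibre -/

namespace PretzelElimination

section Torsion

variable {K : Type*} [CommRing K]

/-- D stays monic over K/(k), hence is not a zero divisor there, even when K/(k) is not a domain. -/
theorem C_dvd_of_C_dvd_monic_mul {D c : Polynomial K} (hD : D.Monic) {k : K}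
    (h : Polynomial.C k ∣ D * c) : Polynomial.C k ∣ c := by
  have key : ∀ f : Polynomial K, Polynomial.C k ∣ f ↔
      f.map (Ideal.Quotient.mk (Ideal.span {k})) = 0 := by
    intro f
    rw [Polynomial.C_dvd_iff_dvd_coeff, Polynomial.ext_iff]
    simp [Ideal.Quotient.eq_zero_iff_mem, Ideal.mem_span_singleton]
  rw [key, Polynomial.map_mul] at h
  rw [key]
  exact ((hD.map _).mul_right_eq_zero_iff).mp h

/-- If the ideal `(p, q)` of `K[y][z]`, with `p` monic in `z`, contains a polynomial that is monic
in `y` and free of `z`, then the quotient by `(p, q)` has no `K`-torsion. -/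
theorem mem_span_pair_of_C_C_mul_mem [IsDomain K] {p q u v : Polynomial (Polynomial K)}
    {D : Polynomial K} (hp : p.Monic) (hD : D.Monic) (huv : Polynomial.C D = u * p + v * q)
    {k : K} (hk : k ≠ 0) {f : Polynomial (Polynomial K)}
    (hf : Polynomial.C (Polynomial.C k) * f ∈ Ideal.span {p, q}) : f ∈ Ideal.span {p, q} := by
  obtain ⟨g, h, hgh⟩ := Ideal.mem_span_pair.mp hf
  -- Multiply kf = gp + hq by v and use vq ≡ D modulo p: then Dh ≡ kvf. As D is monic, k divides the
  -- remainder of h, and it can be cancelled from kf modulo the monic p.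
  have h1 : D • (h %ₘ p) = Polynomial.C k • ((v * f) %ₘ p) := by
    rw [← Polynomial.smul_modByMonic, ← Polynomial.smul_modByMonic, Polynomial.smul_eq_C_mul,
      Polynomial.smul_eq_C_mul]
    rw [← sub_eq_zero, ← Polynomial.sub_modByMonic, Polynomial.modByMonic_eq_zero_iff_dvd hp]
    exact ⟨h * u - v * g, by linear_combination h * huv + v * hgh⟩
  have h2 : Polynomial.C (Polynomial.C k) ∣ h %ₘ p := by
    rw [Polynomial.C_dvd_iff_dvd_coeff]
    intro i
    refine C_dvd_of_C_dvd_monic_mul hD ⟨((v * f) %ₘ p).coeff i, ?_⟩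
    simpa using congrArg (fun t => Polynomial.coeff t i) h1
  obtain ⟨h', hh'⟩ := h2
  have h3 := Polynomial.modByMonic_add_div h p
  have h4 : p ∣ Polynomial.C (Polynomial.C k) * (f - h' * q) :=
    ⟨g + h /ₘ p * q, by linear_combination -hgh - q * h3 + q * hh'⟩
  rw [← Polynomial.modByMonic_eq_zero_iff_dvd hp, ← Polynomial.smul_eq_C_mul,
    Polynomial.smul_modByMonic, smul_eq_zero_iff_right (Polynomial.C_ne_zero.mpr hk),
    Polynomial.modByMonic_eq_zero_iff_dvd hp] at h4
  obtain ⟨r, hr⟩ := h4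
  exact Ideal.mem_span_pair.mpr ⟨r, h', by linear_combination -hr⟩

theorem finite_quotient_of_monic_mem {p : Polynomial (Polynomial K)} {D : Polynomial K}
    {I : Ideal (Polynomial (Polynomial K))} (hp : p.Monic) (hD : D.Monic)
    (hpI : p ∈ I) (hDI : Polynomial.C D ∈ I) : Module.Finite K (Polynomial (Polynomial K) ⧸ I) := by
  have h1 : (algebraMap K (Polynomial K ⧸ Ideal.span {D})).Finite := by
    have := hD.finite_quotient
    exact (RingHom.finite_algebraMap).mpr this
  have hle : Ideal.span {p} ≤ I := (Ideal.span_singleton_le_iff_mem I).mpr hpI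
  have h3 : (algebraMap (Polynomial K) (Polynomial (Polynomial K) ⧸ I)).Finite := by
    have := hp.finite_quotient
    let φ : (Polynomial (Polynomial K) ⧸ Ideal.span {p}) →ₐ[Polynomial K]
        (Polynomial (Polynomial K) ⧸ I) := Ideal.Quotient.factorₐ _ hle
    have hφ : Function.Surjective φ.toLinearMap := Ideal.Quotient.factor_surjective hle
    have := Module.Finite.of_surjective _ hφ
    exact RingHom.finite_algebraMap.mpr this
  have hker : ∀ a ∈ Ideal.span {D}, ((Ideal.Quotient.mk I).comp Polynomial.C) a = 0 := by
    intro a ha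
    obtain ⟨b, rfl⟩ := Ideal.mem_span_singleton'.mp ha
    refine Ideal.Quotient.eq_zero_iff_mem.mpr ?_
    rw [map_mul]
    exact Ideal.mul_mem_left _ _ hDI
  have h4 : RingHom.Finite (A := Polynomial K ⧸ Ideal.span {D}) (B := Polynomial (Polynomial K) ⧸ I)
      (Ideal.Quotient.lift (Ideal.span {D}) _ hker) :=
    RingHom.Finite.of_comp_finite (A := Polynomial K) (B := Polynomial K ⧸ Ideal.span {D})
      (C := Polynomial (Polynomial K) ⧸ I) (f := Ideal.Quotient.mk (Ideal.span {D})) h3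
  exact (RingHom.finite_algebraMap (A := K) (B := Polynomial (Polynomial K) ⧸ I)).mp (h4.comp h1)

/-- Reducedness of a finite torsion-free algebra can be checked on one fibre. -/
theorem isReduced_of_isReduced_fiber {R : Type*} [CommRing R] [Algebra K R] [IsNoetherianRing K]
    [IsDomain K] [Module.Finite K R] {t : K} (ht : ¬ IsUnit t)
    (htors : ∀ (k : K) (r : R), k ≠ 0 → k • r = 0 → r = 0) (ht0 : t ≠ 0)
    (hfib : ∀ r : R, IsNilpotent r → ∃ s, r = t • s) : IsReduced R := by
  set N : Submodule K R := (nilradical R).restrictScalars K with hN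
  have hle : N ≤ Ideal.span {t} • N := by
    intro r hr
    obtain ⟨s, rfl⟩ := hfib r hr
    refine Submodule.smul_mem_smul (Ideal.mem_span_singleton_self t) ?_
    -- Torsion-freeness removes tᵐ from (ts)ᵐ = 0, so s is nilpotent as well.
    obtain ⟨m, hm⟩ : IsNilpotent (t • s) := hr
    refine ⟨m, htors (t ^ m) _ (pow_ne_zero _ ht0) ?_⟩
    rw [← smul_pow, hm]
  -- Nakayama: some k ≡ 1 modulo t annihilates N, and k ≠ 0 because t is not a unit.
  obtain ⟨k, hk, hkN⟩ := Submodule.exists_sub_one_mem_and_smul_eq_zero_of_fg_of_le_smul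
    (Ideal.span {t}) N (IsNoetherian.noetherian N) hle
  refine ⟨fun r hr => htors k r ?_ (hkN r hr)⟩
  rintro rfl
  rw [zero_sub, neg_mem_iff, ← Ideal.eq_top_iff_one, Ideal.span_singleton_eq_top] at hk
  exact ht hk

/-- Radicality of `(p, q)` in `K[y][z]` can be checked on one fibre over `K`, provided that `p` is
monic in `z` and that the ideal contains a polynomial that is monic in `y` and free of `z`. -/
theorem isRadical_span_pair_of_fiber [IsDomain K] [IsNoetherianRing K]
    {p q u v : Polynomial (Polynomial K)} {D : Polynomial K} (hp : p.Monic) (hD : D.Monic)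
    (huv : Polynomial.C D = u * p + v * q) {t : K} (ht : ¬ IsUnit t) (ht0 : t ≠ 0)
    (hfib : ∀ (f : Polynomial (Polynomial K)) (m : ℕ), f ^ m ∈ Ideal.span {p, q} →
      ∃ s, f - Polynomial.C (Polynomial.C t) * s ∈ Ideal.span {p, q}) :
    (Ideal.span {p, q}).IsRadical := by
  have hmem := fun (k : K) (hk : k ≠ 0) f => mem_span_pair_of_C_C_mul_mem hp hD huv hk (f := f)
  have hfin := finite_quotient_of_monic_mem (I := Ideal.span {p, q}) hp hD
    (Ideal.subset_span (by simp)) (Ideal.mem_span_pair.mpr ⟨u, v, huv.symm⟩)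
  generalize Ideal.span {p, q} = I at *
  refine (Ideal.isRadical_iff_quotient_reduced _).mpr ?_
  have hsmul : ∀ (k : K) (f : Polynomial (Polynomial K)),
      k • Ideal.Quotient.mk I f = Ideal.Quotient.mk I (Polynomial.C (Polynomial.C k) * f) := by
    intro k f
    have h : k • f = Polynomial.C (Polynomial.C k) * f := Algebra.smul_def k f
    rw [← h]
    rfl
  refine isReduced_of_isReduced_fiber (K := K) (R := Polynomial (Polynomial K) ⧸ I) ht ?_ ht0 ?_
  · intro k r hk hr
    obtain ⟨f, rfl⟩ := Ideal.Quotient.mk_surjective r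
    rw [hsmul] at hr
    exact Ideal.Quotient.eq_zero_iff_mem.mpr (hmem k hk f (Ideal.Quotient.eq_zero_iff_mem.mp hr))
  · intro r hr
    obtain ⟨f, rfl⟩ := Ideal.Quotient.mk_surjective r
    obtain ⟨m, hm⟩ := hr
    rw [← map_pow] at hm
    obtain ⟨s, hs⟩ := hfib f m (Ideal.Quotient.eq_zero_iff_mem.mp hm)
    exact ⟨Ideal.Quotient.mk _ s, (Ideal.Quotient.eq.mpr hs).trans (hsmul t s).symm⟩

end Torsion

/-! ### Radical ideals in the plane -/

section Fiber

variable {F : Type*} [Field F]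

theorem dvd_of_C_mem_span_pair {c E u : Polynomial F}
    (h : Polynomial.C u ∈ Ideal.span {Polynomial.X ^ 2 + Polynomial.C c, Polynomial.C E}) :
    E ∣ u := by
  have hZ : (Polynomial.X ^ 2 + Polynomial.C c).Monic := Polynomial.monic_X_pow_add_C c two_ne_zero
  obtain ⟨a, b, hab⟩ := Ideal.mem_span_pair.mp h
  refine ⟨(b %ₘ (Polynomial.X ^ 2 + Polynomial.C c)).coeff 0, ?_⟩
  have h1 : (Polynomial.C u) %ₘ (Polynomial.X ^ 2 + Polynomial.C c) = Polynomial.C u := by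
    rw [Polynomial.modByMonic_eq_self_iff hZ, Polynomial.degree_X_pow_add_C two_pos]
    exact lt_of_le_of_lt Polynomial.degree_C_le (by norm_num)
  have h2 : (Polynomial.C u) %ₘ (Polynomial.X ^ 2 + Polynomial.C c)
      = E • (b %ₘ (Polynomial.X ^ 2 + Polynomial.C c)) := by
    rw [← Polynomial.smul_modByMonic, Polynomial.smul_eq_C_mul, ← sub_eq_zero,
      ← Polynomial.sub_modByMonic, Polynomial.modByMonic_eq_zero_iff_dvd hZ]
    exact ⟨a, by linear_combination -hab⟩
  rw [h1] at h2
  simpa using congrArg (fun t => Polynomial.coeff t 0) h2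

/-- The double cover z² = -c of the reduced scheme E = 0 is unramified, as c does not vanish there.
The proof separates the even and odd parts in z by means of z ↦ -z. -/
theorem isRadical_span_X_sq_add_C (h2 : (2 : F) ≠ 0) {c E : Polynomial F} (hE : E.Separable)
    (hc : IsCoprime E c) :
    (Ideal.span {Polynomial.X ^ 2 + Polynomial.C c, Polynomial.C E}).IsRadical := by
  set J := Ideal.span {Polynomial.X ^ 2 + Polynomial.C c, Polynomial.C E} with hJ
  have hZ : (Polynomial.X ^ 2 + Polynomial.C c).Monic := Polynomial.monic_X_pow_add_C c two_ne_zero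
  have hZJ : Polynomial.X ^ 2 + Polynomial.C c ∈ J := Ideal.subset_span (by simp)
  have hEJ : Polynomial.C E ∈ J := Ideal.subset_span (by simp)
  have hrad : ∀ u, Polynomial.C u ∈ J.radical → E ∣ u := by
    rintro u ⟨m, hm⟩
    rw [← map_pow] at hm
    exact hE.squarefree.isRadical m u (dvd_of_C_mem_span_pair hm)
  have hconj : ∀ f ∈ J.radical, f.comp (-Polynomial.X) ∈ J.radical := by
    rintro f ⟨m, hm⟩
    refine ⟨m, ?_⟩
    obtain ⟨a, b, hab⟩ := Ideal.mem_span_pair.mp hm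
    refine Ideal.mem_span_pair.mpr ⟨a.comp (-Polynomial.X), b.comp (-Polynomial.X), ?_⟩
    rw [← Polynomial.pow_comp, ← hab]
    simp only [Polynomial.add_comp, Polynomial.mul_comp, Polynomial.C_comp, Polynomial.X_comp,
      Polynomial.pow_comp]
    ring
  intro f hf
  obtain ⟨g, h, hgh⟩ : ∃ g h : Polynomial F,
      f %ₘ (Polynomial.X ^ 2 + Polynomial.C c) = Polynomial.C h * Polynomial.X + Polynomial.C g := by
    refine ⟨_, _, Polynomial.eq_X_add_C_of_degree_le_one ?_⟩
    have := Polynomial.degree_modByMonic_lt f hZ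
    rw [Polynomial.degree_X_pow_add_C two_pos] at this
    exact Order.le_of_lt_succ this
  have hdiv := Polynomial.modByMonic_add_div f (Polynomial.X ^ 2 + Polynomial.C c)
  rw [hgh] at hdiv
  have hr : Polynomial.C h * Polynomial.X + Polynomial.C g ∈ J.radical := by
    have : Polynomial.C h * Polynomial.X + Polynomial.C g
        = f - (Polynomial.X ^ 2 + Polynomial.C c) * (f /ₘ (Polynomial.X ^ 2 + Polynomial.C c)) := by
      linear_combination hdiv
    rw [this]
    exact sub_mem hf (Ideal.mul_mem_right _ _ (Ideal.le_radical hZJ))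
  have hr' := hconj _ hr
  have hg : E ∣ g := by
    have h3 : Polynomial.C (Polynomial.C 2 * g) ∈ J.radical := by
      convert add_mem hr hr' using 1
      simp only [Polynomial.add_comp, Polynomial.mul_comp, Polynomial.C_comp, Polynomial.X_comp,
        map_mul, map_ofNat]
      ring
    exact (Polynomial.isUnit_C.mpr (isUnit_iff_ne_zero.mpr h2)).dvd_mul_left.mp (hrad _ h3)
  have hh : E ∣ h := by
    -- With g removed, hz lies in the radical, and h²c = h²(z² + c) - (hz)².
    have h3 : Polynomial.C (h ^ 2 * c) ∈ J.radical := by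
      have h4 := Ideal.le_radical (I := J) (Ideal.mem_span_pair.mpr
        ⟨Polynomial.C h ^ 2, 0, rfl⟩)
      have hgJ : Polynomial.C g ∈ J.radical := by
        obtain ⟨w, rfl⟩ := hg
        rw [map_mul]
        exact Ideal.mul_mem_right _ _ (Ideal.le_radical hEJ)
      have h5 : Polynomial.C h * Polynomial.X ∈ J.radical := by
        simpa using sub_mem hr hgJ
      convert sub_mem h4 (Ideal.mul_mem_left _ (Polynomial.C h * Polynomial.X) h5) using 1
      simp only [map_mul, map_pow]
      ring
    have h6 := hc.dvd_of_dvd_mul_right (hrad _ h3)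
    exact hE.squarefree.isRadical 2 h h6
  rw [← hdiv]
  obtain ⟨g', rfl⟩ := hg
  obtain ⟨h', rfl⟩ := hh
  refine add_mem (add_mem ?_ ?_) (Ideal.mul_mem_right _ _ hZJ)
  · rw [map_mul, mul_assoc]
    exact Ideal.mul_mem_right _ _ hEJ
  · rw [map_mul]
    exact Ideal.mul_mem_right _ _ hEJ

theorem isRadical_span_X_C {T : Polynomial F} (hT : T.Separable) :
    (Ideal.span {Polynomial.X, Polynomial.C T}).IsRadical := by
  rintro f ⟨m, hm⟩
  obtain ⟨a, b, hab⟩ := Ideal.mem_span_pair.mp hm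
  have h1 : T ∣ f.eval 0 := by
    refine hT.squarefree.isRadical m _ ⟨b.eval 0, ?_⟩
    have := congrArg (Polynomial.eval 0) hab
    simp only [Polynomial.eval_add, Polynomial.eval_mul, Polynomial.eval_X, Polynomial.eval_C,
      Polynomial.eval_pow] at this
    linear_combination -this
  obtain ⟨w, hw⟩ := h1
  rw [← Polynomial.coeff_zero_eq_eval_zero] at hw
  refine Ideal.mem_span_pair.mpr ⟨f.divX, Polynomial.C w, ?_⟩
  conv_rhs => rw [← Polynomial.divX_mul_X_add f, hw, map_mul]
  ring

/-- The plane scheme cut out by `z (z² + c)` and `T - U z²` is the disjoint union of two reduced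
pieces, lying on `z = 0` and on `z² = -c`. -/
theorem isRadical_span_plane (h2 : (2 : F) ≠ 0) {c T U E : Polynomial F} (hE : E = T + c * U)
    (hTs : T.Separable) (hEs : E.Separable) (hc : IsCoprime E c) :
    (Ideal.span {Polynomial.X * (Polynomial.X ^ 2 + Polynomial.C c),
      Polynomial.C T - Polynomial.C U * Polynomial.X ^ 2}).IsRadical := by
  set I := Ideal.span {Polynomial.X * (Polynomial.X ^ 2 + Polynomial.C c),
      Polynomial.C T - Polynomial.C U * Polynomial.X ^ 2} with hI
  set J₁ := Ideal.span {(Polynomial.X : Polynomial (Polynomial F)), Polynomial.C T} with hJ₁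
  set J₂ := Ideal.span {Polynomial.X ^ 2 + Polynomial.C c, Polynomial.C E} with hJ₂
  have hCE : Polynomial.C E = Polynomial.C T + Polynomial.C c * Polynomial.C U := by
    rw [hE, map_add, map_mul]
  -- The sum J₁ + J₂ contains E and c = (z² + c) - z·z, which are coprime.
  have hcop : IsCoprime J₁ J₂ := by
    rw [Ideal.isCoprime_iff_exists]
    obtain ⟨s, t, hst⟩ := hc
    refine ⟨-Polynomial.C t * Polynomial.X * Polynomial.X, Ideal.mul_mem_left _ _
      (Ideal.subset_span (by simp)), _, Ideal.mem_span_pair.mpr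
      ⟨Polynomial.C t, Polynomial.C s, rfl⟩, ?_⟩
    have := congrArg (Polynomial.C (R := Polynomial F)) hst
    simp only [map_add, map_mul, map_one] at this
    linear_combination this
  have hIeq : I = J₁ ⊓ J₂ := by
    apply le_antisymm
    · rw [hI, Ideal.span_le]
      rintro f (rfl | rfl)
      · exact ⟨Ideal.mul_mem_right _ _ (Ideal.subset_span (by simp)),
          Ideal.mul_mem_left _ _ (Ideal.subset_span (by simp))⟩
      · exact ⟨Ideal.mem_span_pair.mpr ⟨-Polynomial.C U * Polynomial.X, 1, by ring⟩,
          Ideal.mem_span_pair.mpr ⟨-Polynomial.C U, 1, by rw [hCE]; ring⟩⟩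
    · rw [← Ideal.mul_eq_inf_of_isCoprime hcop, hJ₁, hJ₂, Ideal.span_pair_mul_span_pair,
        Ideal.span_le]
      rintro f (rfl | rfl | rfl | rfl)
      · exact Ideal.subset_span (by simp)
      · exact Ideal.mem_span_pair.mpr ⟨Polynomial.C U, Polynomial.X, by rw [hCE]; ring⟩
      · exact Ideal.mem_span_pair.mpr ⟨Polynomial.C U * Polynomial.X,
          Polynomial.X ^ 2 + Polynomial.C c, by ring⟩
      · exact Ideal.mem_span_pair.mpr ⟨Polynomial.C U ^ 2 * Polynomial.X,
          Polynomial.C E + Polynomial.C U * Polynomial.X ^ 2,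
          by rw [hCE]; ring⟩
  rw [hIeq]
  exact (isRadical_span_X_C hTs).inf (isRadical_span_X_sq_add_C h2 hEs hc)

end Fiber

end PretzelElimination

/-! ### The fibre x = 0 and the radicality of (P, Q_n) -/

namespace PretzelElimination

theorem evalP_monic {A : Type*} [CommRing A] [Nontrivial A] (x y : A) :
    (evalP (Polynomial.C x) (Polynomial.C y) Polynomial.X : Polynomial A).Monic := by
  have h : (evalP (Polynomial.C x) (Polynomial.C y) Polynomial.X : Polynomial A)
      = Polynomial.X ^ 3 + (Polynomial.C (x - x * y)
        + Polynomial.C (-3 + x ^ 2 + y ^ 2) * Polynomial.X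
        - Polynomial.C (x * y) * Polynomial.X ^ 2) := by
    simp only [evalP, map_sub, map_mul, map_add, map_neg, map_pow, map_ofNat]
    ring
  rw [h]
  refine Polynomial.monic_X_pow_add (lt_of_le_of_lt (Polynomial.degree_le_of_natDegree_le
    (n := 2) ?_) (by norm_num))
  compute_degree

/-- `P` in `ℂ[x][y][z]`. -/
noncomputable def iterP : Polynomial (Polynomial (Polynomial ℂ)) :=
  evalP (Polynomial.C (Polynomial.C Polynomial.X)) (Polynomial.C Polynomial.X) Polynomial.X

/-- `Q_n` in `ℂ[x][y][z]`. -/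
noncomputable def iterQ (n : ℤ) : Polynomial (Polynomial (Polynomial ℂ)) :=
  evalQ (Polynomial.C (Polynomial.C Polynomial.X)) (Polynomial.C Polynomial.X) Polynomial.X
    (Polynomial.C (Polynomial.Chebyshev.S _ (n - 2)))
    (Polynomial.C (Polynomial.Chebyshev.S _ (n - 3)))

theorem exists_monic_eq_combination (n : ℤ) :
    ∃ (D : Polynomial (Polynomial ℂ)) (u v : Polynomial (Polynomial (Polynomial ℂ))),
      D.Monic ∧ Polynomial.C D = u * iterP + v * iterQ n := by
  have hpell := congrArg (Polynomial.C (R := Polynomial (Polynomial ℂ)))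
    (ChebyshevS.S_pell (Polynomial ℂ) (n - 1))
  have e : n - 1 - 1 = n - 2 := by ring
  rw [e] at hpell
  simp only [map_add, map_sub, map_mul, map_pow, map_one] at hpell
  have hS := congrArg (Polynomial.C (R := Polynomial (Polynomial ℂ)))
    (Polynomial.Chebyshev.S_sub_two (Polynomial ℂ) (n - 1))
  have e3 : n - 1 - 2 = n - 3 := by ring
  rw [e3, e, map_sub, map_mul] at hS
  refine ⟨_, _, _, monic_normQ (Polynomial.X : Polynomial ℂ) n, Eq.trans ?_
    (normQ_eq_combination (A := Polynomial (Polynomial (Polynomial ℂ)))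
      (Polynomial.C (Polynomial.C Polynomial.X)) (Polynomial.C Polynomial.X) Polynomial.X
      _ _ _ hpell hS)⟩
  simp only [normQ, map_add, map_sub, map_mul, map_pow, map_one, map_ofNat]

section Fiber

variable {F : Type*} [Field F]

/-- The specialization `x = 0`. -/
noncomputable def fiberMap (F : Type*) [Field F] :
    Polynomial (Polynomial (Polynomial F)) →+* Polynomial (Polynomial F) :=
  Polynomial.mapRingHom (Polynomial.mapRingHom (Polynomial.evalRingHom 0))

theorem fiberMap_surjective : Function.Surjective (fiberMap F) :=
  Polynomial.map_surjective _ (Polynomial.map_surjective _ fun a => ⟨Polynomial.C a, by simp⟩)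

theorem C_C_X_dvd_sub_of_fiberMap_eq {f g : Polynomial (Polynomial (Polynomial F))}
    (hf : fiberMap F f = fiberMap F g) : Polynomial.C (Polynomial.C Polynomial.X) ∣ f - g := by
  rw [Polynomial.C_dvd_iff_dvd_coeff]
  intro i
  rw [Polynomial.C_dvd_iff_dvd_coeff]
  intro j
  rw [Polynomial.X_dvd_iff, Polynomial.coeff_zero_eq_eval_zero, Polynomial.coeff_sub,
    Polynomial.coeff_sub, Polynomial.eval_sub, sub_eq_zero]
  have := congrArg (fun t => (Polynomial.coeff t i).coeff j) hf
  simpa [fiberMap] using this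

theorem isRadical_of_isRadical_fiber {p q u v : Polynomial (Polynomial (Polynomial F))}
    {D : Polynomial (Polynomial F)} (hp : p.Monic) (hD : D.Monic)
    (huv : Polynomial.C D = u * p + v * q)
    (hfib : (Ideal.span {fiberMap F p, fiberMap F q}).IsRadical) :
    Ideal.IsRadical (R := Polynomial (Polynomial (Polynomial F))) (Ideal.span {p, q}) := by
  refine isRadical_span_pair_of_fiber (K := Polynomial F) hp hD huv Polynomial.not_isUnit_X
    Polynomial.X_ne_zero ?_
  intro f m hm
  obtain ⟨a, b, hab⟩ := Ideal.mem_span_pair.mp hm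
  have h1 : fiberMap F f ∈ Ideal.span {fiberMap F p, fiberMap F q} := by
    refine hfib ⟨m, Ideal.mem_span_pair.mpr ⟨fiberMap F a, fiberMap F b, ?_⟩⟩
    rw [← map_pow, ← hab]
    simp only [map_add, map_mul]
  obtain ⟨a', b', hab'⟩ := Ideal.mem_span_pair.mp h1
  obtain ⟨a', rfl⟩ := fiberMap_surjective a'
  obtain ⟨b', rfl⟩ := fiberMap_surjective b'
  obtain ⟨s, hs⟩ := C_C_X_dvd_sub_of_fiberMap_eq (f := f) (g := a' * p + b' * q)
    (by rw [map_add, map_mul, map_mul, hab'])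
  refine ⟨s, ?_⟩
  rw [← hs, sub_sub_cancel]
  exact Ideal.mem_span_pair.mpr ⟨a', b', rfl⟩

end Fiber

theorem fiberMap_iterP : fiberMap ℂ iterP
    = Polynomial.X * (Polynomial.X ^ 2 + Polynomial.C (Polynomial.X ^ 2 - 3)) := by
  simp only [fiberMap, iterP, evalP, Polynomial.coe_mapRingHom, Polynomial.map_add,
    Polynomial.map_sub, Polynomial.map_mul, Polynomial.map_pow, Polynomial.map_C,
    Polynomial.map_X, Polynomial.map_neg, Polynomial.coe_evalRingHom, Polynomial.eval_X,
    map_zero, map_sub, map_pow, Polynomial.map_ofNat, map_ofNat]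
  ring

theorem fiberMap_iterQ (n : ℤ) : fiberMap ℂ (iterQ n)
    = Polynomial.C ((Polynomial.X + 2) * ChebyshevS.diffS ℂ (n - 3))
      - Polynomial.C (Polynomial.Chebyshev.S ℂ (n - 2) + Polynomial.Chebyshev.S ℂ (n - 3))
        * Polynomial.X ^ 2 := by
  have hS := Polynomial.Chebyshev.S_sub_two ℂ (n - 2)
  have e3 : n - 2 - 1 = n - 3 := by ring
  have e4 : n - 2 - 2 = n - 3 - 1 := by ring
  rw [e3, e4] at hS
  simp only [fiberMap, iterQ, evalQ, Polynomial.coe_mapRingHom, Polynomial.map_C,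
    Polynomial.map_X, Polynomial.coe_evalRingHom, Polynomial.eval_X, map_zero, map_sub, map_pow,
    map_ofNat, Polynomial.Chebyshev.map_S, ChebyshevS.diffS, hS, map_mul, map_add,
    Polynomial.map_one]
  ring

/-- On z = 0 the polynomial Q_n restricts to (y+2) `diffS` (n-3). On the conic z² = 3 - y² it
becomes `sumS` n, which has no zero at y² = 3, where the two components meet. -/
theorem isRadical_span_fiber (n : ℤ) :
    (Ideal.span {fiberMap ℂ iterP, fiberMap ℂ (iterQ n)}).IsRadical := by
  rw [fiberMap_iterP, fiberMap_iterQ]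
  refine isRadical_span_plane two_ne_zero (E := ChebyshevS.sumS ℂ n) ?_
    (ChebyshevS.separable_X_add_two_mul_diffS _) (ChebyshevS.separable_sumS n)
    (ChebyshevS.isCoprime_sumS_X_sq_sub_three n)
  have h4 := Polynomial.Chebyshev.S_sub_two ℂ (n - 2)
  have h1 := Polynomial.Chebyshev.S_sub_two ℂ (n - 1)
  have h0 := Polynomial.Chebyshev.S_sub_two ℂ n
  have e3 : n - 2 - 1 = n - 3 := by ring
  have e4 : n - 2 - 2 = n - 3 - 1 := by ring
  have e5 : n - 1 - 1 = n - 2 := by ring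
  have e6 : n - 1 - 2 = n - 3 := by ring
  rw [e3, e4] at h4
  rw [e5, e6] at h1
  simp only [ChebyshevS.sumS, ChebyshevS.diffS]
  rw [h4, h1]
  linear_combination h0

theorem isRadical_span_iterP_iterQ (n : ℤ) :
    Ideal.IsRadical (R := Polynomial (Polynomial (Polynomial ℂ)))
      (Ideal.span {iterP, iterQ n}) := by
  obtain ⟨D, u, v, hD, huv⟩ := exists_monic_eq_combination n
  exact isRadical_of_isRadical_fiber (evalP_monic _ _) hD huv (isRadical_span_fiber n)

/-- The inclusion of `ℂ[x][y]` in `ℂ[x, y, z]`. -/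
noncomputable def ofIterXY : Polynomial (Polynomial ℂ) →ₐ[ℂ] MvPolynomial (Fin 3) ℂ :=
  Polynomial.eval₂AlgHom (Polynomial.aeval (X 0)) (X 1) fun _ => Commute.all _ _

/-- The identification of `ℂ[x][y][z]` with `ℂ[x, y, z]`. -/
noncomputable def ofIter : Polynomial (Polynomial (Polynomial ℂ)) →ₐ[ℂ] MvPolynomial (Fin 3) ℂ :=
  Polynomial.eval₂AlgHom ofIterXY (X 2) fun _ => Commute.all _ _

theorem ofIter_X : ofIter Polynomial.X = X 2 := Polynomial.eval₂_X _ _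

theorem ofIter_C_X : ofIter (Polynomial.C Polynomial.X) = X 1 :=
  (Polynomial.eval₂_C _ _).trans (Polynomial.eval₂_X _ _)

theorem ofIter_C_C_X : ofIter (Polynomial.C (Polynomial.C Polynomial.X)) = X 0 :=
  (Polynomial.eval₂_C _ _).trans ((Polynomial.eval₂_C _ _).trans (Polynomial.aeval_X _))

/-- `ℂ[x, y, z]` as an iterated polynomial ring. -/
noncomputable def iterEquiv :
    MvPolynomial (Fin 3) ℂ ≃ₐ[ℂ] Polynomial (Polynomial (Polynomial ℂ)) :=
  AlgEquiv.ofAlgHom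
    (aeval (S₁ := Polynomial (Polynomial (Polynomial ℂ)))
      ![Polynomial.C (Polynomial.C Polynomial.X), Polynomial.C Polynomial.X, Polynomial.X])
    ofIter
    (by
      refine Polynomial.algHom_ext' (Polynomial.algHom_ext' (Polynomial.algHom_ext ?_) ?_) ?_ <;>
        simp [ofIter_X, ofIter_C_X, ofIter_C_C_X])
    (by
      refine MvPolynomial.algHom_ext fun i => ?_
      fin_cases i <;> simp [ofIter_X, ofIter_C_X, ofIter_C_C_X])

theorem iterEquiv_X_zero : iterEquiv (X 0) = Polynomial.C (Polynomial.C Polynomial.X) := by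
  simp [iterEquiv]

theorem iterEquiv_X_one : iterEquiv (X 1) = Polynomial.C Polynomial.X := by
  simp [iterEquiv]

theorem iterEquiv_X_two : iterEquiv (X 2) = Polynomial.X := by
  simp [iterEquiv]

theorem iterEquiv_polyP : iterEquiv polyP = iterP := by
  simp only [polyP, iterP, evalP, map_add, map_sub, map_mul, map_pow, map_neg, map_ofNat,
    iterEquiv_X_zero, iterEquiv_X_one, iterEquiv_X_two]

theorem iterEquiv_chebS (k : ℤ) :
    iterEquiv (chebS k) = Polynomial.C (Polynomial.Chebyshev.S (Polynomial ℂ) k) := by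
  have h := Polynomial.Chebyshev.aeval_S (R := Polynomial ℂ) (R' := Polynomial (Polynomial ℂ))
    Polynomial.X k
  rw [Polynomial.aeval_X_left_apply] at h
  rw [chebS, ← Polynomial.aeval_algHom_apply, iterEquiv_X_one, h]
  exact (Polynomial.Chebyshev.aeval_S (R := ℂ) (R' := Polynomial (Polynomial (Polynomial ℂ)))
    (Polynomial.C Polynomial.X) k).trans
    (Polynomial.Chebyshev.algebraMap_eval_S (R := Polynomial (Polynomial ℂ))
      (R' := Polynomial (Polynomial (Polynomial ℂ))) Polynomial.X k).symm

theorem polyQ_eq_evalQ (n : ℤ) :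
    polyQ n = evalQ (X 0) (X 1) (X 2) (chebS (n - 2)) (chebS (n - 3)) := by
  have hS : ∀ k, chebS (k - 2) = X 1 * chebS (k - 1) - chebS k := by
    intro k
    simp only [chebS, Polynomial.Chebyshev.S_sub_two, map_sub, map_mul, Polynomial.aeval_X]
  have h5 := hS (n - 3)
  have h4 := hS (n - 2)
  have h3 := hS (n - 1)
  have e1 : n - 3 - 2 = n - 5 := by ring
  have e2 : n - 3 - 1 = n - 4 := by ring
  have e3 : n - 2 - 2 = n - 4 := by ring
  have e4 : n - 2 - 1 = n - 3 := by ring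
  have e5 : n - 1 - 2 = n - 3 := by ring
  have e6 : n - 1 - 1 = n - 2 := by ring
  rw [e1, e2] at h5
  rw [e3, e4] at h4
  rw [e5, e6] at h3
  unfold polyQ evalQ
  linear_combination -h5 + (-1 - X 1 + X 0 * X 2) * h4 + X 0 * X 2 * h3

theorem iterEquiv_polyQ (n : ℤ) : iterEquiv (polyQ n) = iterQ n := by
  simp only [polyQ_eq_evalQ, iterQ, evalQ, map_add, map_sub, map_mul, map_pow, map_ofNat, map_one,
    iterEquiv_X_zero, iterEquiv_X_one, iterEquiv_X_two, iterEquiv_chebS]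

theorem isRadical_span_polyP_polyQ (n : ℤ) : (Ideal.span {polyP, polyQ n}).IsRadical := by
  rintro f ⟨m, hm⟩
  obtain ⟨a, b, hab⟩ := Ideal.mem_span_pair.mp hm
  have h : iterEquiv f ∈ Ideal.span {iterP, iterQ n} := by
    refine isRadical_span_iterP_iterQ n ⟨m, Ideal.mem_span_pair.mpr
      ⟨iterEquiv a, iterEquiv b, ?_⟩⟩
    rw [← map_pow, ← hab, map_add, map_mul, map_mul, iterEquiv_polyP, iterEquiv_polyQ]
  obtain ⟨a', b', hab'⟩ := Ideal.mem_span_pair.mp h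
  refine Ideal.mem_span_pair.mpr ⟨iterEquiv.symm a', iterEquiv.symm b', iterEquiv.injective ?_⟩
  rw [map_add, map_mul, map_mul, iterEquiv_polyP, iterEquiv_polyQ, iterEquiv.apply_symm_apply,
    iterEquiv.apply_symm_apply, hab']

end PretzelElimination

/-! ### Trace functions and skein linearity -/

/-- Functions on a group that satisfy the trace identities of `SL₂`. -/
structure IsTraceFunction {G S : Type*} [Group G] [CommRing S] (T : G → S) : Prop where
  one : T 1 = 2
  mul : ∀ g h, T g * T h = T (g * h) + T (g * h⁻¹)

/-- Functions `D` on a group such that `h + h⁻¹` acts as the scalar `T h` in every argument of a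
product. -/
def IsSkeinLinear {G S : Type*} [Group G] [CommRing S] (T D : G → S) : Prop :=
  ∀ g h k, D (g * h * k) + D (g * h⁻¹ * k) = T h * D (g * k)

namespace IsSkeinLinear

variable {G S : Type*} [Group G] [CommRing S] {T D : G → S}

theorem translate (hD : IsSkeinLinear T D) (u : G) : IsSkeinLinear T fun g => D (u * g) := by
  intro g h k
  simpa only [mul_assoc] using hD (u * g) h k

theorem sub {E : G → S} (hD : IsSkeinLinear T D) (hE : IsSkeinLinear T E) :
    IsSkeinLinear T fun g => D g - E g := by
  intro g h k
  linear_combination hD g h k - hE g h k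

theorem mul_inv_mul (hD : IsSkeinLinear T D) (g h k : G) :
    D (g * h⁻¹ * k) = T h * D (g * k) - D (g * h * k) := by
  linear_combination hD g h k

theorem mul_inv (hD : IsSkeinLinear T D) (g h : G) : D (g * h⁻¹) = T h * D g - D (g * h) := by
  simpa using hD.mul_inv_mul g h 1

theorem mul_self_mul (hD : IsSkeinLinear T D) (g h k : G) :
    D (g * h * h * k) = T h * D (g * h * k) - D (g * k) := by
  have := hD.mul_inv_mul (g * h) h k
  rw [mul_inv_cancel_right] at this
  linear_combination this

theorem mul_self (hD : IsSkeinLinear T D) (g h : G) : D (g * h * h) = T h * D (g * h) - D g := by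
  simpa using hD.mul_self_mul g h 1

/-- Apply the scalar action of aw + (aw)⁻¹ after gw: the inverse term collapses to ga⁻¹. -/
theorem mul_palindrome (hD : IsSkeinLinear T D) (g a w : G) :
    D (g * w * a * w) = T (a * w) * D (g * w) - T a * D g + D (g * a) := by
  have h1 := hD.mul_inv (g * w) (a * w)
  have h2 := hD.mul_inv g a
  rw [mul_inv_rev, ← mul_assoc, ← mul_assoc, mul_inv_cancel_right] at h1
  linear_combination h1 - h2

/-- The inverse of aw⁻¹ is wa⁻¹. Expanding D(gwa⁻¹) once through a and once through aw⁻¹ brings w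
past a. -/
theorem mul_swap (hD : IsSkeinLinear T D) (g a w : G) : D (g * w * a)
    = T a * D (g * w) - T (a * w⁻¹) * D g + T w * D (g * a) - D (g * a * w) := by
  have h1 := hD.mul_inv (g * w) a
  have h2 := hD.mul_inv g (a * w⁻¹)
  have h3 := hD.mul_inv (g * a) w
  rw [mul_inv_rev, inv_inv, ← mul_assoc, ← mul_assoc] at h2
  linear_combination h1 - h2 + h3

/-- If `a` and `w` generate `G`, then a skein linear function takes all its values in any module
over the traces of `a`, `w`, `a w` that contains the values at `1`, `a`, `w`, `a w`. -/
theorem mem_of_closure (hD : IsSkeinLinear T D) {a w : G} (hG : Subgroup.closure {a, w} = ⊤)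
    (haw : T (a * w⁻¹) = T a * T w - T (a * w)) (M : AddSubgroup S)
    (hMa : ∀ s ∈ M, T a * s ∈ M) (hMw : ∀ s ∈ M, T w * s ∈ M) (hMaw : ∀ s ∈ M, T (a * w) * s ∈ M)
    (h1 : D 1 ∈ M) (h2 : D a ∈ M) (h3 : D w ∈ M) (h4 : D (a * w) ∈ M) (g : G) : D g ∈ M := by
  -- Membership at g alone does not propagate. The values at g, ga, gw, gaw do: multiplying g by a
  -- generator or its inverse again gives combinations of these four.
  have key : ∀ g, D g ∈ M ∧ D (g * a) ∈ M ∧ D (g * w) ∈ M ∧ D (g * a * w) ∈ M := by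
    have step : ∀ g, (D g ∈ M ∧ D (g * a) ∈ M ∧ D (g * w) ∈ M ∧ D (g * a * w) ∈ M) →
        D (g * w * a) ∈ M ∧ D (g * w * a * w) ∈ M := by
      rintro g ⟨i1, i2, i3, i4⟩
      constructor
      · rw [hD.mul_swap, haw, sub_mul, mul_assoc]
        exact M.sub_mem (M.add_mem (M.sub_mem (hMa _ i3) (M.sub_mem (hMa _ (hMw _ i1))
          (hMaw _ i1))) (hMw _ i2)) i4
      · rw [hD.mul_palindrome]
        exact M.add_mem (M.sub_mem (hMaw _ i3) (hMa _ i1)) i2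
    intro g
    have hg : g ∈ Subgroup.closure {a, w} := hG ▸ Subgroup.mem_top g
    induction hg using Subgroup.closure_induction_right with
    | one => simpa using ⟨h1, h2, h3, h4⟩
    | mul_right g _ y hy ih =>
      have hs := step g ih
      obtain ⟨i1, i2, i3, i4⟩ := ih
      rcases hy with rfl | rfl
      · refine ⟨i2, ?_, i4, ?_⟩
        · rw [hD.mul_self]
          exact M.sub_mem (hMa _ i2) i1
        · rw [hD.mul_self_mul]
          exact M.sub_mem (hMa _ i4) i3
      · refine ⟨i3, hs.1, ?_, hs.2⟩
        rw [hD.mul_self]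
        exact M.sub_mem (hMw _ i3) i1
    | mul_inv_cancel g _ y hy ih =>
      have hs := step g ih
      obtain ⟨i1, i2, i3, i4⟩ := ih
      rcases hy with rfl | rfl
      · rw [inv_mul_cancel_right, hD.mul_inv, hD.mul_inv_mul]
        exact ⟨M.sub_mem (hMa _ i1) i2, i1, M.sub_mem (hMa _ i3) i4, i3⟩
      · rw [inv_mul_cancel_right, hD.mul_inv, hD.mul_inv_mul, mul_assoc _ a, hD.mul_inv_mul,
          ← mul_assoc, ← mul_assoc]
        exact ⟨M.sub_mem (hMw _ i1) i3, M.sub_mem (hMw _ i2) hs.1, i1,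
          M.sub_mem (hMw _ i4) hs.2⟩
  exact (key g).1

end IsSkeinLinear

namespace IsTraceFunction

variable {G S : Type*} [Group G] [CommRing S] {T : G → S}

theorem inv (hT : IsTraceFunction T) (g : G) : T g⁻¹ = T g := by
  have h := hT.mul 1 g
  rw [hT.one, one_mul, one_mul] at h
  linear_combination -h

theorem mul_comm (hT : IsTraceFunction T) (g h : G) : T (g * h) = T (h * g) := by
  have h1 := hT.mul g h
  have h2 := hT.mul h g
  have h3 := hT.inv (g * h⁻¹)
  rw [mul_inv_rev, inv_inv] at h3
  linear_combination h2 - h1 + h3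

theorem conj (hT : IsTraceFunction T) (g h : G) : T (g * h * g⁻¹) = T h := by
  rw [hT.mul_comm, inv_mul_cancel_left]

theorem mul_inv (hT : IsTraceFunction T) (g h : G) : T (g * h⁻¹) = T g * T h - T (g * h) := by
  linear_combination -hT.mul g h

theorem isSkeinLinear (hT : IsTraceFunction T) : IsSkeinLinear T T := by
  intro g h k
  have := hT.mul (k * g) h
  rw [hT.mul_comm (g * h), hT.mul_comm (g * h⁻¹), hT.mul_comm g, ← mul_assoc, ← mul_assoc]
  linear_combination -this

theorem comp (hT : IsTraceFunction T) {H : Type*} [Group H] (f : H →* G) :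
    IsTraceFunction fun h => T (f h) :=
  ⟨by simpa using hT.one, fun g h => by simpa using hT.mul (f g) (f h)⟩

theorem map (hT : IsTraceFunction T) {R : Type*} [CommRing R] (f : S →+* R) :
    IsTraceFunction fun g => f (T g) :=
  ⟨by rw [hT.one, map_ofNat], fun g h => by simpa using congrArg f (hT.mul g h)⟩

theorem mem_subalgebra {R : Type*} [CommRing R] [Algebra R S] (hT : IsTraceFunction T) {a w : G}
    (hG : Subgroup.closure {a, w} = ⊤) (B : Subalgebra R S) (ha : T a ∈ B) (hw : T w ∈ B)
    (haw : T (a * w) ∈ B) (g : G) : T g ∈ B :=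
  hT.isSkeinLinear.mem_of_closure hG (hT.mul_inv a w) B.toSubring.toAddSubgroup
    (fun _ hs => B.mul_mem ha hs) (fun _ hs => B.mul_mem hw hs) (fun _ hs => B.mul_mem haw hs)
    (show T 1 ∈ B by rw [hT.one]; exact ofNat_mem B 2) ha hw haw g

/-- Equality of `T (u g)` and `T (v g)` for all `g` has to be checked at four places only. -/
theorem translate_eq (hT : IsTraceFunction T) {a w : G} (hG : Subgroup.closure {a, w} = ⊤)
    {u v : G} (h1 : T u = T v) (ha : T (u * a) = T (v * a)) (hw : T (u * w) = T (v * w))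
    (haw : T (u * (a * w)) = T (v * (a * w))) (g : G) : T (u * g) = T (v * g) := by
  have := ((hT.isSkeinLinear.translate u).sub (hT.isSkeinLinear.translate v)).mem_of_closure hG
    (hT.mul_inv a w) ⊥ (by simp) (by simp) (by simp) (by simpa [sub_eq_zero]) (by simpa [sub_eq_zero])
    (by simpa [sub_eq_zero]) (by simpa [sub_eq_zero]) g
  simpa [sub_eq_zero] using this

/-- The elements that act trivially on a trace function. -/
def kernel {T : G → S} (_hT : IsTraceFunction T) : Subgroup G where
  carrier := {k | ∀ g, T (k * g) = T g}
  one_mem' := by simp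
  mul_mem' {k l} hk hl g := by rw [mul_assoc, hk, hl]
  inv_mem' {k} hk g := by rw [← hk, mul_inv_cancel_left]

instance kernel_normal (hT : IsTraceFunction T) : hT.kernel.Normal := by
  refine ⟨fun k hk h g => ?_⟩
  rw [mul_assoc, mul_assoc, hT.mul_comm, mul_assoc, hk, hT.mul_comm, mul_inv_cancel_left]

theorem mul_inv_mem_kernel (hT : IsTraceFunction T) {u v : G} (h : ∀ g, T (u * g) = T (v * g)) :
    u * v⁻¹ ∈ hT.kernel := by
  intro g
  rw [mul_assoc, h, mul_inv_cancel_left]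

theorem eq_of_inv_mul_mem_kernel (hT : IsTraceFunction T) {u v : G} (h : u⁻¹ * v ∈ hT.kernel) :
    T u = T v := by
  have := h u
  rwa [hT.mul_comm, mul_inv_cancel_left, eq_comm] at this

end IsTraceFunction

/-! ### The universal character ring -/

section UniversalCharacterRing

variable {G : Type*} [Group G]

theorem isTraceFunction_formalTrace : IsTraceFunction (formalTrace (G := G)) := by
  constructor
  · have h : (X 1 - C 2 : MvPolynomial G ℂ) ∈ characterIdeal G :=
      Ideal.subset_span (Or.inl rfl)
    have := Ideal.Quotient.eq.mpr h
    rwa [map_ofNat C 2, map_ofNat] at this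
  · intro g h
    have h : (X g * X h - (X (g * h) + X (g * h⁻¹)) : MvPolynomial G ℂ) ∈ characterIdeal G :=
      Ideal.subset_span (Or.inr ⟨g, h, rfl⟩)
    have := Ideal.Quotient.eq.mpr h
    rwa [map_mul, map_add] at this

namespace IsTraceFunction

variable {S : Type*} [CommRing S] [Algebra ℂ S] {T : G → S}

/-- The universal property of the universal character ring. -/
noncomputable def lift (hT : IsTraceFunction T) : UniversalCharacterRing G →ₐ[ℂ] S :=
  Ideal.Quotient.liftₐ (characterIdeal G) (aeval T) <| by
    have : characterIdeal G ≤ RingHom.ker (aeval T : MvPolynomial G ℂ →ₐ[ℂ] S) := by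
      rw [characterIdeal, Ideal.span_le]
      rintro f (rfl | ⟨g, h, rfl⟩)
      · simp [RingHom.mem_ker, hT.one, map_ofNat C 2]
      · simp [RingHom.mem_ker, hT.mul g h]
    exact fun f hf => RingHom.mem_ker.mp (this hf)

@[simp]
theorem lift_formalTrace (hT : IsTraceFunction T) (g : G) : hT.lift (formalTrace g) = T g :=
  aeval_X T g

end IsTraceFunction

theorem adjoin_formalTrace : Algebra.adjoin ℂ (Set.range (formalTrace (G := G))) = ⊤ := by
  rw [eq_top_iff]
  rintro f -
  obtain ⟨p, rfl⟩ := Ideal.Quotient.mk_surjective f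
  induction p using MvPolynomial.induction_on with
  | C c => exact Subalgebra.algebraMap_mem _ c
  | add p q hp hq => rw [map_add]; exact add_mem hp hq
  | mul_X p g hp => rw [map_mul]; exact mul_mem hp (Algebra.subset_adjoin ⟨g, rfl⟩)

/-- Polynomials in the traces of `a`, `w`, `a w`. -/
noncomputable def evalTraces (a w : G) : MvPolynomial (Fin 3) ℂ →ₐ[ℂ] UniversalCharacterRing G :=
  aeval ![formalTrace a, formalTrace w, formalTrace (a * w)]

theorem evalTraces_surjective {a w : G} (hG : Subgroup.closure {a, w} = ⊤) :
    Function.Surjective (evalTraces a w) := by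
  rw [← AlgHom.range_eq_top, eq_top_iff, ← adjoin_formalTrace, Algebra.adjoin_le_iff]
  rintro _ ⟨g, rfl⟩
  exact isTraceFunction_formalTrace.mem_subalgebra hG (evalTraces a w).range
    ⟨X 0, by simp [evalTraces]⟩ ⟨X 1, by simp [evalTraces]⟩ ⟨X 2, by simp [evalTraces]⟩ g

end UniversalCharacterRing

/-! ### Trace polynomials of the free group and the trace ideal -/

namespace TracePolynomial

theorem SL_isTraceFunction (K : Type*) [CommRing K] :
    IsTraceFunction fun g : Matrix.SpecialLinearGroup (Fin 2) K => g.1.trace := by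
  constructor
  · simp
  · intro g h
    change g.1.trace * h.1.trace = (g.1 * h.1).trace + (g.1 * h.1.adjugate).trace
    generalize g.1 = A, h.1 = B
    simp only [Matrix.adjugate_fin_two, Matrix.trace_fin_two, Matrix.mul_apply, Fin.sum_univ_two,
      Matrix.of_apply, Matrix.cons_val_zero, Matrix.cons_val_one, Matrix.cons_val']
    ring

theorem closure_free : Subgroup.closure {FreeGroup.of (0 : Fin 2), FreeGroup.of 1} = ⊤ := by
  rw [← FreeGroup.closure_range_of (Fin 2)]
  congr 1
  ext g
  simp [Fin.exists_fin_two, eq_comm]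

theorem exists_polynomial (v : FreeGroup (Fin 2)) : ∃ p : MvPolynomial (Fin 3) ℂ,
    evalTraces (FreeGroup.of (0 : Fin 2)) (FreeGroup.of 1) p = formalTrace v :=
  evalTraces_surjective closure_free _

/-- The trace polynomial of a word. -/
noncomputable def tracePoly (v : FreeGroup (Fin 2)) : MvPolynomial (Fin 3) ℂ :=
  (exists_polynomial v).choose

/-- The polynomial was chosen by an identity in the universal ring of F_2, so it serves every trace
function with values in a ℂ-algebra, not only characters of representations. -/
theorem aeval_tracePoly {S : Type*} [CommRing S] [Algebra ℂ S] {T : FreeGroup (Fin 2) → S}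
    (hT : IsTraceFunction T) (v : FreeGroup (Fin 2)) :
    aeval (fun i => T (traceWords i)) (tracePoly v) = T v := by
  have h := congrArg hT.lift (exists_polynomial v).choose_spec
  rw [hT.lift_formalTrace, ← AlgHom.comp_apply] at h
  rw [← h, tracePoly]
  congr 1
  ext i
  fin_cases i <;> simp [evalTraces, traceWords]

theorem isTracePolynomial_tracePoly (v : FreeGroup (Fin 2)) :
    IsTracePolynomial traceWords v (tracePoly v) := by
  intro ρ
  rw [← coe_aeval_eq_eval]
  exact aeval_tracePoly ((SL_isTraceFunction ℂ).comp ρ) v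

/-- A companion matrix for a and an upper triangular matrix for w realize any three traces; the
eigenvalue m exists over ℂ. Trace polynomials are therefore unique, and their identities can be
checked pointwise. -/
theorem exists_representation (s : Fin 3 → ℂ) :
    ∃ ρ : FreeGroup (Fin 2) →* Matrix.SpecialLinearGroup (Fin 2) ℂ,
      (fun i => (ρ (traceWords i)).1.trace) = s := by
  obtain ⟨m, hm⟩ : ∃ m : ℂ, m ^ 2 - s 1 * m + 1 = 0 := by
    obtain ⟨r, hr⟩ := IsAlgClosed.exists_pow_nat_eq (s 1 ^ 2 - 4) (n := 2) (by norm_num)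
    exact ⟨(s 1 + r) / 2, by linear_combination hr / 4⟩
  refine ⟨FreeGroup.lift ![⟨!![s 0, -1; 1, 0], by simp⟩, ⟨!![m, s 2 - s 0 * m; 0, s 1 - m], by
    rw [Matrix.det_fin_two_of]; linear_combination -hm⟩], ?_⟩
  funext i
  fin_cases i
  · simp [traceWords, Matrix.trace_fin_two]
  · simp [traceWords, Matrix.trace_fin_two]
  · simp only [traceWords, Fin.reduceFinMk, Matrix.cons_val, map_mul, FreeGroup.lift_apply_of,
      Matrix.trace_fin_two]
    change (!![s 0, -1; 1, 0] * !![m, s 2 - s 0 * m; 0, s 1 - m]) 0 0 +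
      (!![s 0, -1; 1, 0] * !![m, s 2 - s 0 * m; 0, s 1 - m]) 1 1 = s 2
    simp [Matrix.mul_apply]

theorem IsTracePolynomial.unique {v : FreeGroup (Fin 2)} {p q : MvPolynomial (Fin 3) ℂ}
    (hp : IsTracePolynomial traceWords v p) (hq : IsTracePolynomial traceWords v q) : p = q := by
  refine MvPolynomial.funext fun s => ?_
  obtain ⟨ρ, rfl⟩ := exists_representation s
  rw [hp ρ, hq ρ]

theorem isTraceFunction_tracePoly : IsTraceFunction tracePoly := by
  constructor
  · refine MvPolynomial.funext fun s => ?_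
    obtain ⟨ρ, rfl⟩ := exists_representation s
    rw [isTracePolynomial_tracePoly 1 ρ]
    simp
  · intro g h
    refine MvPolynomial.funext fun s => ?_
    obtain ⟨ρ, rfl⟩ := exists_representation s
    simp only [map_mul, map_add, isTracePolynomial_tracePoly _ ρ]
    simpa using ((SL_isTraceFunction ℂ).comp ρ).mul g h

theorem tracePoly_traceWords (i : Fin 3) : tracePoly (traceWords i) = X i :=
  IsTracePolynomial.unique (isTracePolynomial_tracePoly _) fun ρ => by simp

theorem traceIdeal_eq {G : Type*} [Group G] (π : FreeGroup (Fin 2) →* G) :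
    traceIdeal π traceWords =
      Ideal.span {f | ∃ v w, π v = π w ∧ f = tracePoly v - tracePoly w} := by
  unfold traceIdeal
  congr 1
  ext f
  constructor
  · rintro ⟨v, w, p, q, h, hp, hq, rfl⟩
    exact ⟨v, w, h, by rw [IsTracePolynomial.unique hp (isTracePolynomial_tracePoly v),
      IsTracePolynomial.unique hq (isTracePolynomial_tracePoly w)]⟩
  · rintro ⟨v, w, h, rfl⟩
    exact ⟨v, w, _, _, h, isTracePolynomial_tracePoly v, isTracePolynomial_tracePoly w, rfl⟩

theorem closure_map_eq_top {G : Type*} [Group G] {π : FreeGroup (Fin 2) →* G}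
    (hπ : Function.Surjective π) :
    Subgroup.closure {π (FreeGroup.of 0), π (FreeGroup.of 1)} = ⊤ := by
  have h := π.map_closure {FreeGroup.of (0 : Fin 2), FreeGroup.of 1}
  rw [closure_free, ← MonoidHom.range_eq_map, π.range_eq_top.mpr hπ, Set.image_pair] at h
  exact h.symm

/-- Modulo the trace ideal, trace polynomials depend only on the image in G, so they form a trace
function on G. The homomorphism it induces on the universal ring, composed with `evalTraces`, is the
quotient map; this bounds the kernel from above. -/
theorem ker_evalTraces {G : Type*} [Group G] {π : FreeGroup (Fin 2) →* G}
    (hπ : Function.Surjective π) :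
    RingHom.ker (evalTraces (π (FreeGroup.of 0)) (π (FreeGroup.of 1))) =
      traceIdeal π traceWords := by
  have heval : evalTraces (π (FreeGroup.of 0)) (π (FreeGroup.of 1)) =
      aeval (fun i => formalTrace (π (traceWords i))) := by
    ext i
    fin_cases i <;> simp [evalTraces, traceWords]
  apply le_antisymm
  · set I := traceIdeal π traceWords with hI
    have hmk : ∀ u v, π u = π v →
        Ideal.Quotient.mk I (tracePoly u) = Ideal.Quotient.mk I (tracePoly v) := by
      intro u v h
      rw [Ideal.Quotient.eq, hI, traceIdeal_eq]
      exact Ideal.subset_span ⟨u, v, h, rfl⟩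
    have hτ := isTraceFunction_tracePoly.map (Ideal.Quotient.mk I)
    let T : G → MvPolynomial (Fin 3) ℂ ⧸ I :=
      fun g => Ideal.Quotient.mk I (tracePoly (Function.surjInv hπ g))
    have hTπ : ∀ v, T (π v) = Ideal.Quotient.mk I (tracePoly v) :=
      fun v => hmk _ _ (Function.surjInv_eq hπ _)
    have hT : IsTraceFunction T := by
      constructor
      · rw [← map_one π, hTπ]
        exact hτ.one
      · intro g h
        obtain ⟨g, rfl⟩ := hπ g
        obtain ⟨h, rfl⟩ := hπ h
        rw [← map_inv, ← map_mul π, ← map_mul π, hTπ, hTπ, hTπ, hTπ]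
        exact hτ.mul g h
    intro f hf
    have h1 : hT.lift.comp (evalTraces (π (FreeGroup.of 0)) (π (FreeGroup.of 1))) =
        Ideal.Quotient.mkₐ ℂ I := by
      rw [heval]
      ext i
      simp [hTπ, tracePoly_traceWords]
    rw [← Ideal.Quotient.eq_zero_iff_mem, ← Ideal.Quotient.mkₐ_eq_mk ℂ, ← h1, AlgHom.comp_apply,
      RingHom.mem_ker.mp hf, map_zero]
  · rw [traceIdeal_eq, Ideal.span_le]
    rintro _ ⟨u, v, h, rfl⟩
    have h1 := aeval_tracePoly (isTraceFunction_formalTrace.comp π)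
    rw [SetLike.mem_coe, RingHom.mem_ker, heval, map_sub, h1, h1, h, sub_self]

end TracePolynomial

/-! ### Twisted columns and the presentation of the knot group -/

section halfTwist

variable {H K : Type*} [Group H] [Group K]

@[simp]
theorem halfTwist_apply (s : H × H) : halfTwist H s = (s.1 * s.2 * s.1⁻¹, s.1) := rfl

@[simp]
theorem halfTwist_symm_apply (s : H × H) : (halfTwist H)⁻¹ s = (s.2, s.2⁻¹ * s.1 * s.2) := rfl

theorem map_halfTwist_zpow (f : H →* K) (k : ℤ) (s : H × H) :
    Prod.map f f ((halfTwist H ^ k) s) = (halfTwist K ^ k) (Prod.map f f s) := by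
  induction k using Int.induction_on generalizing s with
  | zero => rfl
  | succ k ih =>
    rw [zpow_add_one, zpow_add_one, Equiv.Perm.mul_apply, Equiv.Perm.mul_apply, ih]
    simp
  | pred k ih =>
    rw [zpow_sub_one, zpow_sub_one, Equiv.Perm.mul_apply, Equiv.Perm.mul_apply, ih]
    simp

/-- A full twist conjugates both meridians by their product. -/
theorem halfTwist_zpow_two_mul (k : ℤ) (x y : H) : (halfTwist H ^ (2 * k)) (x, y) =
    ((x * y) ^ k * x * ((x * y) ^ k)⁻¹, (x * y) ^ k * y * ((x * y) ^ k)⁻¹) := by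
  rw [zpow_mul]
  induction k using Int.induction_on generalizing x y with
  | zero => simp
  | succ k ih =>
    have h : (halfTwist H ^ (2 : ℤ)) (x, y) = (x * y * x * (x * y)⁻¹, x * y * y * (x * y)⁻¹) := by
      rw [zpow_two, Equiv.Perm.mul_apply]
      simp [mul_assoc]
    have h' : x * y * x * (x * y)⁻¹ * (x * y * y * (x * y)⁻¹) = x * y := by group
    rw [zpow_add_one, Equiv.Perm.mul_apply, h, ih, h', zpow_add_one]
    simp [mul_assoc]
  | pred k ih =>
    have h : (halfTwist H ^ (2 : ℤ))⁻¹ (x, y) = ((x * y)⁻¹ * x * (x * y), (x * y)⁻¹ * y * (x * y)) := by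
      rw [Equiv.Perm.inv_eq_iff_eq, zpow_two, Equiv.Perm.mul_apply]
      simp [mul_assoc]
    have h' : (x * y)⁻¹ * x * (x * y) * ((x * y)⁻¹ * y * (x * y)) = x * y := by group
    rw [zpow_sub_one, Equiv.Perm.mul_apply, h, ih, h', zpow_sub_one]
    simp [mul_assoc]

end halfTwist

namespace PretzelKnot

variable {H : Type*} [Group H]

theorem map_pretzelBottom (f : FreeGroup (Fin 3) →* H) (p : Fin 3 → ℤ) (i : Fin 3) :
    Prod.map f f (pretzelBottom p i) =
      (halfTwist H ^ p i) ((f (FreeGroup.of (i - 1)))⁻¹, f (FreeGroup.of i)) := by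
  rw [pretzelBottom, map_halfTwist_zpow, Prod.map_apply, map_inv]

/-- Full twists conjugate by a product of meridians, so -2 = 2·(-1), 3 = 1 + 2·1 and 2n+1 = 1 + 2n
give the bottom meridians in closed form. Up to conjugation, the relators 0 and 2 are the two stated
relations. -/
theorem map_rels_eq_one_iff (f : FreeGroup (Fin 3) →* H) (n : ℤ) {a b c : H}
    (ha : f (FreeGroup.of 0) = a) (hb : f (FreeGroup.of 2) = b) (hc : f (FreeGroup.of 1) = c⁻¹) :
    (∀ r ∈ pretzelRels ![-2, 3, 2 * n + 1], f r = 1) ↔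
      c * a * (c * b) = a * (c * b) * a ∧ a * (c * b) ^ n * c = b * a * (c * b) ^ n := by
  have hw : (c * b) ^ n * (c * b) = (c * b) * (c * b) ^ n := (Commute.refl (c * b)).zpow_left n
  have h0 : Prod.map f f (pretzelBottom ![-2, 3, 2 * n + 1] 0) =
      (a⁻¹ * b⁻¹ * a, a⁻¹ * b * a * b⁻¹ * a) := by
    rw [map_pretzelBottom, show (0 : Fin 3) - 1 = 2 from rfl, ha, hb,
      show ![-2, 3, 2 * n + 1] (0 : Fin 3) = 2 * (-1) from rfl, halfTwist_zpow_two_mul]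
    simp [mul_assoc]
  have h1 : Prod.map f f (pretzelBottom ![-2, 3, 2 * n + 1] 1) =
      (a⁻¹ * c⁻¹ * a⁻¹ * c⁻¹ * a * c * a, a⁻¹ * c⁻¹ * a⁻¹ * c * a) := by
    rw [map_pretzelBottom, show (1 : Fin 3) - 1 = 0 from rfl, ha, hc,
      show ![-2, 3, 2 * n + 1] (1 : Fin 3) = 1 + 2 * 1 from rfl, zpow_one_add, Equiv.Perm.mul_apply,
      halfTwist_zpow_two_mul]
    simp [mul_assoc]
  have h2 : Prod.map f f (pretzelBottom ![-2, 3, 2 * n + 1] 2) =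
      ((c * b) ^ n * c * b * c⁻¹ * ((c * b) ^ n)⁻¹, (c * b) ^ n * c * ((c * b) ^ n)⁻¹) := by
    rw [map_pretzelBottom, show (2 : Fin 3) - 1 = 1 from rfl, hb, hc, inv_inv,
      show ![-2, 3, 2 * n + 1] (2 : Fin 3) = 1 + 2 * n from add_comm _ _, zpow_one_add,
      Equiv.Perm.mul_apply, halfTwist_zpow_two_mul]
    generalize (c * b) ^ n = t
    simp [mul_assoc]
  rw [Prod.map_apply', Prod.mk.injEq] at h0 h1 h2
  have hall : (∀ r ∈ pretzelRels ![-2, 3, 2 * n + 1], f r = 1) ↔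
      ∀ i, f (pretzelBottom ![-2, 3, 2 * n + 1] i).2 *
        f (pretzelBottom ![-2, 3, 2 * n + 1] (i + 1)).1 = 1 := by
    simp [pretzelRels]
  rw [hall, Fin.forall_fin_succ, Fin.forall_fin_succ, Fin.forall_fin_succ]
  simp only [Fin.succ_zero_eq_one, Fin.succ_one_eq_two, zero_add, Fin.forall_fin_zero,
    show (1 : Fin 3) + 1 = 2 from rfl, show (2 : Fin 3) + 1 = 0 from rfl, h0, h1, h2, and_true]
  generalize (c * b) ^ n = t at hw
  have e0 : a⁻¹ * b * a * b⁻¹ * a * (a⁻¹ * c⁻¹ * a⁻¹ * c⁻¹ * a * c * a) =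
      (a⁻¹ * c⁻¹ * a⁻¹) * (a * (c * b) * a * (c * a * (c * b))⁻¹) * (a⁻¹ * c⁻¹ * a⁻¹)⁻¹ := by group
  have e2 : t * c * t⁻¹ * (a⁻¹ * b⁻¹ * a) = a⁻¹ * (a * t * c * (b * a * t)⁻¹) * a⁻¹⁻¹ := by group
  rw [e0, e2, conj_eq_one_iff, conj_eq_one_iff, mul_inv_eq_one, mul_inv_eq_one, eq_comm,
    and_congr_right_iff]
  -- As usual for Wirtinger relations one is redundant: the middle one follows from the other two.
  refine fun hr => and_iff_right_of_imp fun hs => ?_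
  have e1 : a⁻¹ * c⁻¹ * a⁻¹ * c * a * (t * c * b * c⁻¹ * t⁻¹) =
      a⁻¹ * c⁻¹ * a⁻¹ * c * a * (t * (c * b)) * c⁻¹ * t⁻¹ := by group
  have e3 : c⁻¹ = (b * a * t)⁻¹ * (a * t) := by rw [← hs]; group
  have e4 : a⁻¹ * c⁻¹ * a⁻¹ * c * a * (c * b * t) * ((b * a * t)⁻¹ * (a * t)) * t⁻¹ =
      a⁻¹ * c⁻¹ * a⁻¹ * (c * a * (c * b)) * a⁻¹ * b⁻¹ * a := by group
  have e5 : a⁻¹ * c⁻¹ * a⁻¹ * (a * (c * b) * a) * a⁻¹ * b⁻¹ * a = 1 := by group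
  rw [e1, hw, mul_assoc _ c⁻¹]
  nth_rewrite 2 [e3]
  rw [← mul_assoc, e4, hr, e5]

/-- The left equation is a wⁿ c = b a wⁿ with c = awaw⁻¹a⁻¹ and b = c⁻¹w. Cancelling common outer
factors leaves words whose only inverses are in the powers of w, which suits the trace computation.
-/
theorem relation_iff (a w : H) (n : ℤ) :
    a * w ^ n * (a * w * a * w⁻¹ * a⁻¹) = a * w * a⁻¹ * w⁻¹ * a⁻¹ * w * a * w ^ n ↔
      w * a * w ^ n * a * w = a * w * a * w ^ (n - 1) * a * w * a := by
  have h : w ^ (n - 1) = w⁻¹ * w ^ n := by rw [← zpow_neg_one, ← zpow_add, neg_add_eq_sub]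
  rw [h]
  generalize w ^ n = t
  have h1 : a * t * (a * w * a * w⁻¹ * a⁻¹) = a * w * a⁻¹ * w⁻¹ * a⁻¹ *
      (a * w * a * (w⁻¹ * t) * a * w * a) * (a * w)⁻¹ := by group
  have h2 : a * w * a⁻¹ * w⁻¹ * a⁻¹ * w * a * t = a * w * a⁻¹ * w⁻¹ * a⁻¹ *
      (w * a * t * a * w) * (a * w)⁻¹ := by group
  rw [h1, h2, mul_left_inj, mul_right_inj, eq_comm]

section KnotGroup

variable (n : ℤ)

theorem relations :
    meridianC n * meridianA n * (meridianC n * meridianB n) =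
        meridianA n * (meridianC n * meridianB n) * meridianA n ∧
      meridianA n * (meridianC n * meridianB n) ^ n * meridianC n =
        meridianB n * meridianA n * (meridianC n * meridianB n) ^ n :=
  (map_rels_eq_one_iff (PresentedGroup.mk _) n rfl rfl (inv_inv _).symm).mp
    fun _ hr => PresentedGroup.one_of_mem hr

theorem meridianC_eq : meridianC n = meridianA n * elementW n * meridianA n * (elementW n)⁻¹ *
    (meridianA n)⁻¹ := by
  have h := (relations n).1
  rw [← elementW] at h
  rw [← h]
  group

theorem meridianB_eq : meridianB n = meridianA n * elementW n * (meridianA n)⁻¹ *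
    (elementW n)⁻¹ * (meridianA n)⁻¹ * elementW n := by
  have h : meridianB n = (meridianC n)⁻¹ * elementW n := by rw [elementW]; group
  rw [h, meridianC_eq]
  group

theorem meridianB_conj : meridianB n = meridianA n * elementW n ^ n * meridianC n *
    (meridianA n * elementW n ^ n)⁻¹ := by
  rw [elementW, (relations n).2]
  group

theorem relation_words : elementW n * meridianA n * elementW n ^ n * meridianA n * elementW n =
    meridianA n * elementW n * meridianA n * elementW n ^ (n - 1) * meridianA n * elementW n *
      meridianA n := by
  have h := (relations n).2
  rw [← elementW, meridianB_eq, meridianC_eq] at h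
  exact (relation_iff _ _ n).mp h

theorem wordMap_surjective : Function.Surjective (wordMap n) := by
  rw [← MonoidHom.range_eq_top]
  have ha : meridianA n ∈ (wordMap n).range := ⟨FreeGroup.of 0, by simp [wordMap]⟩
  have hw : elementW n ∈ (wordMap n).range := ⟨FreeGroup.of 1, by simp [wordMap]⟩
  have hc : meridianC n ∈ (wordMap n).range := by
    rw [meridianC_eq]
    exact mul_mem (mul_mem (mul_mem (mul_mem ha hw) ha) (inv_mem hw)) (inv_mem ha)
  have hb : meridianB n ∈ (wordMap n).range := by
    have h : meridianB n = (meridianC n)⁻¹ * elementW n := by rw [elementW]; group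
    rw [h]
    exact mul_mem (inv_mem hc) hw
  rw [eq_top_iff, ← PresentedGroup.closure_range_of, Subgroup.closure_le]
  rintro _ ⟨i, rfl⟩
  fin_cases i
  · exact ha
  · exact inv_mem_iff.mp hc
  · exact hb

variable {n}

/-- The presentation of the knot group with the generators `a` and `w`. -/
theorem exists_hom {a w : H}
    (h : w * a * w ^ n * a * w = a * w * a * w ^ (n - 1) * a * w * a) :
    ∃ φ : KnotGroup n →* H, φ (meridianA n) = a ∧ φ (elementW n) = w := by
  set c := a * w * a * w⁻¹ * a⁻¹ with hc
  set b := c⁻¹ * w with hb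
  have hcb : c * b = w := by rw [hb]; group
  have hrel := (map_rels_eq_one_iff (FreeGroup.lift ![a, c⁻¹, b]) n (a := a) (b := b) (c := c)
    (by simp) (by simp) (by simp)).mpr <| by
      rw [hcb]
      refine ⟨by rw [hc]; group, ?_⟩
      have hb' : b = a * w * a⁻¹ * w⁻¹ * a⁻¹ * w := by rw [hb, hc]; group
      rw [hb']
      exact (relation_iff a w n).mpr h
  refine ⟨PresentedGroup.toGroup hrel, PresentedGroup.toGroup.of hrel, ?_⟩
  rw [elementW, meridianC, meridianB, map_mul, map_inv, PresentedGroup.toGroup.of,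
    PresentedGroup.toGroup.of]
  simpa using hcb

end KnotGroup

end PretzelKnot

/-- Cayley–Hamilton for powers: wᵏ acts as S_{k-1} w - S_{k-2}. -/
theorem IsSkeinLinear.mul_zpow_mul {G S : Type*} [Group G] [CommRing S] [Algebra ℂ S] {T D : G → S}
    (hD : IsSkeinLinear T D) (g w h : G) (k : ℤ) : D (g * w ^ k * h) =
      Polynomial.aeval (T w) (Polynomial.Chebyshev.S ℂ (k - 1)) * D (g * w * h) -
        Polynomial.aeval (T w) (Polynomial.Chebyshev.S ℂ (k - 2)) * D (g * h) := by
  set e : ℤ → S := fun k => Polynomial.aeval (T w) (Polynomial.Chebyshev.S ℂ k) with he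
  have hrec : ∀ k, e (k + 2) = T w * e (k + 1) - e k := by
    intro k
    simp [he, Polynomial.Chebyshev.S_add_two]
  have hDrec : ∀ k : ℤ, D (g * w ^ (k + 2) * h) =
      T w * D (g * w ^ (k + 1) * h) - D (g * w ^ k * h) := by
    intro k
    have := hD.mul_self_mul (g * w ^ k) w h
    rwa [mul_assoc g, ← zpow_add_one, mul_assoc g, ← zpow_add_one, add_assoc] at this
  change _ = e (k - 1) * _ - e (k - 2) * _
  induction k using Polynomial.Chebyshev.induct with
  | zero => simp [he]
  | one => simp [he]
  | add_two k h1 h0 =>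
    have r1 := hrec (k - 1)
    have r2 := hrec (k - 2)
    rw [show (k : ℤ) - 1 + 2 = k + 2 - 1 by ring, show (k : ℤ) - 1 + 1 = k + 1 - 1 by ring] at r1
    rw [show (k : ℤ) - 2 + 2 = k + 2 - 2 by ring, show (k : ℤ) - 2 + 1 = k + 1 - 2 by ring] at r2
    rw [hDrec, h0, h1, r1, r2]
    ring
  | neg_add_one k h1 h0 =>
    have r1 := hrec (-k - 2)
    have r2 := hrec (-k - 3)
    have r3 := hDrec (-k - 1)
    rw [show -(k : ℤ) - 2 + 2 = -k + 1 - 1 by ring, show -(k : ℤ) - 2 + 1 = -k - 1 by ring,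
      show -(k : ℤ) - 2 = -k - 1 - 1 by ring] at r1
    rw [show -(k : ℤ) - 3 + 2 = -k + 1 - 2 by ring, show -(k : ℤ) - 3 + 1 = -k - 2 by ring,
      show -(k : ℤ) - 3 = -k - 1 - 2 by ring] at r2
    rw [show -(k : ℤ) - 1 + 2 = -k + 1 by ring, show -(k : ℤ) - 1 + 1 = -k by ring] at r3
    linear_combination r3 - h0 + T w * h1 - D (g * w * h) * r1 + D (g * h) * r2

/-! ### The trace ideal of the knot group -/

namespace PretzelKnot

open TracePolynomial

local notation "𝐚" => FreeGroup.of (0 : Fin 2)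
local notation "𝐰" => FreeGroup.of (1 : Fin 2)

theorem tracePoly_a : tracePoly 𝐚 = X 0 := tracePoly_traceWords 0
theorem tracePoly_w : tracePoly 𝐰 = X 1 := tracePoly_traceWords 1
theorem tracePoly_aw : tracePoly (𝐚 * 𝐰) = X 2 := tracePoly_traceWords 2

theorem tracePoly_zpow (g h : FreeGroup (Fin 2)) (k : ℤ) : tracePoly (g * 𝐰 ^ k * h) =
    chebS (k - 1) * tracePoly (g * 𝐰 * h) - chebS (k - 2) * tracePoly (g * h) := by
  rw [isTraceFunction_tracePoly.isSkeinLinear.mul_zpow_mul, tracePoly_w, chebS, chebS]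

/-- Rules that compute the trace of every positive word. -/
theorem tracePoly_rules :
    tracePoly 1 = 2 ∧ tracePoly (1 * 𝐚) = X 0 ∧ tracePoly (1 * 𝐰) = X 1 ∧
    tracePoly (1 * 𝐚 * 𝐰) = X 2 ∧
    (∀ g, tracePoly (g * 𝐚 * 𝐚) = X 0 * tracePoly (g * 𝐚) - tracePoly g) ∧
    (∀ g, tracePoly (g * 𝐰 * 𝐰) = X 1 * tracePoly (g * 𝐰) - tracePoly g) ∧
    (∀ g, tracePoly (g * 𝐚 * 𝐚 * 𝐰) = X 0 * tracePoly (g * 𝐚 * 𝐰) - tracePoly (g * 𝐰)) ∧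
    (∀ g, tracePoly (g * 𝐰 * 𝐚 * 𝐰) =
      X 2 * tracePoly (g * 𝐰) - X 0 * tracePoly g + tracePoly (g * 𝐚)) ∧
    ∀ g, tracePoly (g * 𝐰 * 𝐚) = X 0 * tracePoly (g * 𝐰) - (X 0 * X 1 - X 2) * tracePoly g +
      X 1 * tracePoly (g * 𝐚) - tracePoly (g * 𝐚 * 𝐰) := by
  have h := isTraceFunction_tracePoly
  have hs := h.isSkeinLinear
  refine ⟨h.one, ?_, ?_, ?_, fun g => ?_, fun g => ?_, fun g => ?_, fun g => ?_, fun g => ?_⟩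
  · rw [one_mul, tracePoly_a]
  · rw [one_mul, tracePoly_w]
  · rw [one_mul, tracePoly_aw]
  · rw [hs.mul_self, tracePoly_a]
  · rw [hs.mul_self, tracePoly_w]
  · rw [hs.mul_self_mul, tracePoly_a]
  · rw [hs.mul_palindrome, tracePoly_a, tracePoly_aw]
  · rw [hs.mul_swap, h.mul_inv, tracePoly_a, tracePoly_w, tracePoly_aw]

/-- The trace of the word for the meridian `b`. -/
theorem tracePoly_meridianB :
    tracePoly (𝐚 * 𝐰 * 𝐚⁻¹ * 𝐰⁻¹ * 𝐚⁻¹ * 𝐰) = X 0 - polyP := by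
  have h : 𝐚 * 𝐰 * 𝐚⁻¹ * 𝐰⁻¹ * 𝐚⁻¹ * 𝐰 = 1 * 𝐚 * 𝐰 * (𝐚 * 𝐰 * 𝐚)⁻¹ * 𝐰 := by group
  have h' : tracePoly (𝐚 * 𝐰 * 𝐚) = tracePoly (1 * 𝐚 * 𝐰 * 𝐚) := by rw [one_mul]
  rw [h, isTraceFunction_tracePoly.isSkeinLinear.mul_inv_mul, h']
  obtain ⟨h0, h1, h2, h3, h4, h5, h6, h7, h8⟩ := tracePoly_rules
  simp only [← mul_assoc]
  simp only [h0, h1, h2, h3, h4, h5, h6, h7, h8, polyP]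
  ring

/-- The two words whose equality defines the knot group, translated by `g`. -/
noncomputable def traceDiff (n : ℤ) (g : FreeGroup (Fin 2)) : MvPolynomial (Fin 3) ℂ :=
  tracePoly (𝐰 * 𝐚 * 𝐰 ^ n * 𝐚 * 𝐰 * g) -
    tracePoly (𝐚 * 𝐰 * 𝐚 * 𝐰 ^ (n - 1) * 𝐚 * 𝐰 * 𝐚 * g)

/-- Expanding the powers of w leaves four words that do not involve n. The leading `1 *` lets the
rules for `g * …` apply up to the start of a word. -/
theorem traceDiff_eq (n : ℤ) (g : FreeGroup (Fin 2)) : traceDiff n g =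
    ((X 1 * chebS (n - 2) - chebS (n - 3)) * tracePoly (1 * 𝐰 * 𝐚 * 𝐰 * 𝐚 * 𝐰 * g) -
      chebS (n - 2) * tracePoly (1 * 𝐰 * 𝐚 * 𝐚 * 𝐰 * g)) -
    (chebS (n - 2) * tracePoly (1 * 𝐚 * 𝐰 * 𝐚 * 𝐰 * 𝐚 * 𝐰 * 𝐚 * g) -
      chebS (n - 3) * tracePoly (1 * 𝐚 * 𝐰 * 𝐚 * 𝐚 * 𝐰 * 𝐚 * g)) := by
  have hS : chebS (n - 1) = X 1 * chebS (n - 2) - chebS (n - 3) := by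
    have := Polynomial.Chebyshev.S_add_two ℂ (n - 3)
    rw [show n - 3 + 2 = n - 1 by ring, show n - 3 + 1 = n - 2 by ring] at this
    simp [chebS, this]
  have h1 := tracePoly_zpow (𝐰 * 𝐚) (𝐚 * 𝐰 * g) n
  have h2 := tracePoly_zpow (𝐚 * 𝐰 * 𝐚) (𝐚 * 𝐰 * 𝐚 * g) (n - 1)
  rw [show n - 1 - 1 = n - 2 by ring, show n - 1 - 2 = n - 3 by ring] at h2
  simp only [← mul_assoc] at h1 h2
  rw [traceDiff, h1, h2, hS]
  simp only [one_mul]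

/-- These are the four places that `IsTraceFunction.translate_eq` asks for. -/
theorem traceDiff_values (n : ℤ) :
    traceDiff n 1 = (X 2 * chebS (n - 2) + X 2 * chebS (n - 3)) * polyP
      + (X 2 ^ 2 - 1) * polyQ n ∧
    traceDiff n 𝐚 = (X 0 * X 2 * (chebS (n - 2) + chebS (n - 3)) - X 1 * chebS (n - 3)
        + chebS (n - 2) - chebS (n - 3)) * polyP
      + (X 0 * X 2 ^ 2 - X 1 * X 2) * polyQ n ∧
    traceDiff n 𝐰 = (- X 0 * chebS (n - 2) + X 1 * X 2 * (chebS (n - 2) + chebS (n - 3))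
        - X 2 * chebS (n - 2)) * polyP
      + (- X 0 * X 2 + X 1 * X 2 ^ 2 - 1) * polyQ n ∧
    traceDiff n (𝐚 * 𝐰) = (- X 0 ^ 2 * chebS (n - 2)
        + X 0 * X 1 * X 2 * (chebS (n - 2) + chebS (n - 3)) - X 0 * X 2 * chebS (n - 2)
        - X 1 ^ 2 * chebS (n - 3) + X 1 * chebS (n - 2) - X 1 * chebS (n - 3)
        + chebS (n - 2) + chebS (n - 3)) * polyP
      + (- X 0 ^ 2 * X 2 + X 0 * X 1 * X 2 ^ 2 + X 0 * X 1 - X 0 - X 1 ^ 2 * X 2 + X 2)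
        * polyQ n := by
  obtain ⟨h0, h1, h2, h3, h4, h5, h6, h7, h8⟩ := tracePoly_rules
  simp only [traceDiff_eq, PretzelElimination.polyQ_eq_evalQ, PretzelElimination.evalQ, polyP,
    ← mul_assoc _ 𝐚 𝐰, mul_one]
  -- The identities are linear in these two polynomials and need no relation between them.
  generalize chebS (n - 2) = p, chebS (n - 3) = q
  refine ⟨?_, ?_, ?_, ?_⟩
  all_goals
    simp only [h0, h1, h2, h3, h4, h5, h6, h7, h8]
    ring

/-- For ≤, the elements acting trivially on traces modulo (P, Q_n) form a normal subgroup containing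
the relator, so F_2 modulo this subgroup receives a map from G_n. For ≥, both generators are
obtained from trace differences. -/
theorem traceIdeal_wordMap (n : ℤ) :
    traceIdeal (wordMap n) traceWords = Ideal.span {polyP, polyQ n} := by
  have ha : wordMap n 𝐚 = meridianA n := by simp [wordMap]
  have hw : wordMap n 𝐰 = elementW n := by simp [wordMap]
  obtain ⟨d1, d2, d3, d4⟩ := traceDiff_values n
  apply le_antisymm
  · set J := Ideal.span {polyP, polyQ n} with hJ
    have hP : polyP ∈ J := Ideal.subset_span (by simp)
    have hQ : polyQ n ∈ J := Ideal.subset_span (by simp)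
    have hT := isTraceFunction_tracePoly.map (Ideal.Quotient.mk J)
    have hmem : ∀ {g f k}, traceDiff n g = f * polyP + k * polyQ n →
        Ideal.Quotient.mk J (tracePoly (𝐰 * 𝐚 * 𝐰 ^ n * 𝐚 * 𝐰 * g)) =
          Ideal.Quotient.mk J (tracePoly (𝐚 * 𝐰 * 𝐚 * 𝐰 ^ (n - 1) * 𝐚 * 𝐰 * 𝐚 * g)) := by
      intro g f k h
      rw [Ideal.Quotient.eq, ← traceDiff, h]
      exact J.add_mem (J.mul_mem_left _ hP) (J.mul_mem_left _ hQ)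
    have hker := hT.mul_inv_mem_kernel <| hT.translate_eq closure_free
      (by simpa only [mul_one] using hmem d1) (hmem d2) (hmem d3) (hmem d4)
    obtain ⟨φ, hφa, hφw⟩ := exists_hom (n := n) (H := FreeGroup (Fin 2) ⧸ hT.kernel)
      (a := (𝐚 : FreeGroup (Fin 2))) (w := (𝐰 : FreeGroup (Fin 2))) <| by
        have := (QuotientGroup.eq_one_iff _).mpr hker
        rw [QuotientGroup.mk_mul, QuotientGroup.mk_inv, mul_inv_eq_one] at this
        simpa only [QuotientGroup.mk_mul, QuotientGroup.mk_zpow] using this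
    have hφ : φ.comp (wordMap n) = QuotientGroup.mk' hT.kernel := by
      ext i
      fin_cases i
      · exact (congrArg φ ha).trans hφa
      · exact (congrArg φ hw).trans hφw
    rw [traceIdeal_eq, Ideal.span_le]
    rintro _ ⟨u, v, huv, rfl⟩
    rw [SetLike.mem_coe, ← Ideal.Quotient.eq]
    refine hT.eq_of_inv_mul_mem_kernel (QuotientGroup.eq.mp ?_)
    have := congrArg φ huv
    rwa [← MonoidHom.comp_apply, ← MonoidHom.comp_apply, hφ] at this
  · set I := traceIdeal (wordMap n) traceWords with hI
    have hmem : ∀ {u v}, wordMap n u = wordMap n v → tracePoly u - tracePoly v ∈ I := by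
      intro u v h
      rw [hI, traceIdeal_eq]
      exact Ideal.subset_span ⟨u, v, h, rfl⟩
    have hdiff : ∀ g, traceDiff n g ∈ I := by
      refine fun g => hmem ?_
      simp only [map_mul, map_zpow, ha, hw, relation_words]
    have hP : polyP ∈ I := by
      -- This word represents b in G_n as a conjugate of c = (aw)a(aw)⁻¹, so its trace is x, while
      -- the direct word for b has trace x - P.
      have hconj : tracePoly ((𝐚 * 𝐰 ^ n) * ((𝐚 * 𝐰) * 𝐚 * (𝐚 * 𝐰)⁻¹) * (𝐚 * 𝐰 ^ n)⁻¹) = X 0 := by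
        rw [isTraceFunction_tracePoly.conj, isTraceFunction_tracePoly.conj, tracePoly_a]
      have h := hmem (u := (𝐚 * 𝐰 ^ n) * ((𝐚 * 𝐰) * 𝐚 * (𝐚 * 𝐰)⁻¹) * (𝐚 * 𝐰 ^ n)⁻¹)
        (v := 𝐚 * 𝐰 * 𝐚⁻¹ * 𝐰⁻¹ * 𝐚⁻¹ * 𝐰) <| by
          simp only [map_mul, map_inv, map_zpow, ha, hw]
          rw [← meridianB_eq, meridianB_conj, meridianC_eq]
          group
      rwa [hconj, tracePoly_meridianB, sub_sub_cancel] at h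
    have hQ : polyQ n ∈ I := by
      -- The factors xz, -z, -1 are chosen so that the coefficients of Q_n add up to 1: xz(z²-1) -
      -- z(xz²-yz) - (-xz+yz²-1) = 1.
      have h : polyQ n = X 0 * X 2 * traceDiff n 1 - X 2 * traceDiff n 𝐚 - traceDiff n 𝐰 -
          (X 0 * X 2 * (X 2 * chebS (n - 2) + X 2 * chebS (n - 3)) -
            X 2 * (X 0 * X 2 * (chebS (n - 2) + chebS (n - 3)) - X 1 * chebS (n - 3)
              + chebS (n - 2) - chebS (n - 3)) -
            (- X 0 * chebS (n - 2) + X 1 * X 2 * (chebS (n - 2) + chebS (n - 3))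
              - X 2 * chebS (n - 2))) * polyP := by
        rw [d1, d2, d3]
        ring
      rw [h]
      exact I.sub_mem (I.sub_mem (I.sub_mem (I.mul_mem_left _ (hdiff _))
        (I.mul_mem_left _ (hdiff _))) (hdiff _)) (I.mul_mem_left _ hP)
    rw [Ideal.span_le]
    rintro f (rfl | rfl)
    exacts [hP, hQ]

end PretzelKnot

theorem theorem4p2 (n : ℤ) :
    IsReduced (UniversalCharacterRing (KnotGroup n)) ∧
    (∃ e : (MvPolynomial (Fin 3) ℂ ⧸ Ideal.span {polyP, polyQ n}) ≃ₐ[ℂ]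
        UniversalCharacterRing (KnotGroup n),
      e (Ideal.Quotient.mk _ (X 0)) = formalTrace (meridianA n) ∧
      e (Ideal.Quotient.mk _ (X 1)) = formalTrace (elementW n) ∧
      e (Ideal.Quotient.mk _ (X 2)) = formalTrace (meridianA n * elementW n)) ∧
    IsTraceSystem (wordMap n) traceWords ∧
    traceIdeal (wordMap n) traceWords = Ideal.span {polyP, polyQ n} := by
  have hsurj := PretzelKnot.wordMap_surjective n
  have ha : wordMap n (FreeGroup.of 0) = meridianA n := by simp [wordMap]
  have hw : wordMap n (FreeGroup.of 1) = elementW n := by simp [wordMap]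
  have hideal := PretzelKnot.traceIdeal_wordMap n
  have hker := TracePolynomial.ker_evalTraces hsurj
  have heval := evalTraces_surjective (TracePolynomial.closure_map_eq_top hsurj)
  rw [ha, hw] at hker heval
  rw [hideal] at hker
  let e : (MvPolynomial (Fin 3) ℂ ⧸ Ideal.span {polyP, polyQ n}) ≃ₐ[ℂ]
      UniversalCharacterRing (KnotGroup n) :=
    (Ideal.quotientEquivAlgOfEq ℂ hker.symm).trans
      (Ideal.quotientKerAlgEquivOfSurjective heval)
  have he : ∀ p, e (Ideal.Quotient.mk _ p) = evalTraces (meridianA n) (elementW n) p :=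
    fun _ => rfl
  refine ⟨?_, ⟨e, ?_, ?_, ?_⟩, ⟨hsurj, fun v => ⟨_, TracePolynomial.isTracePolynomial_tracePoly v⟩⟩,
    hideal⟩
  · have : IsReduced (MvPolynomial (Fin 3) ℂ ⧸ Ideal.span {polyP, polyQ n}) :=
      (Ideal.isRadical_iff_quotient_reduced _).mp
        (PretzelElimination.isRadical_span_polyP_polyQ n)
    exact isReduced_of_injective e.symm e.symm.injective
  · rw [he, evalTraces, aeval_X]
    rfl
  · rw [he, evalTraces, aeval_X]
    rfl
  · rw [he, evalTraces, aeval_X]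
    rfl
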